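/- Let $e \geqslant 3$ be an integer. For $n \in \mathbb N$ let $\mathsf S_n$ be the set of symmetric $n \times n$ matrices with entries in $\{1,-1\}$ and all diagonal entries equal to $1$, and let $\mathcal C_e(\mathsf S_n)$ be the set of tuples of residue classes modulo $2^e$ \[ \left(a_2 \bmod 2^e,\ a_3 \bmod 2^e,\ \dots,\ a_e \bmod 2^e\right) \] for which there is $M \in \mathsf S_n$ with $\det(xI-M) = \sum_{i=0}^n a_i x^{n-i}$. Then there exists $N$ (depending only on $e$) such that for all $n > N$, \[ |\mathcal C_e(\mathsf S_n)| = \begin{cases} 2^{\binom{e-2}{2}}, & \text{if } n \text{ is even},\\ 2^{\binom{e-2}{2}+1}, & \text{if } n \text{ is odd},\end{cases} \] and the number $|\{\det(xI-M) \bmod 2^e : M \in \mathsf S_n\}|$ of congruence classes modulo $2^e$ of characteristic polynomials of matrices in $\mathsf S_n$ has the same value. (Thus the upper bound of Greaves and Yatsyna for the latter number is attained for all sufficiently large $n$.) -/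

import Mathlib

/-- The symmetric `{±1}`-matrices of order `n` with all diagonal entries equal to `1`. -/
def symmSignMatrices (n : ℕ) : Set (Matrix (Fin n) (Fin n) ℤ) :=
  {M | (∀ i j, M i j = 1 ∨ M i j = -1) ∧ M.transpose = M ∧ ∀ i, M i i = 1}

/-- The integer `a_k` in `det (x I - M) = ∑_{i=0}^n a_i x^(n-i)`
(and `0` if `k > n`, where there is no such coefficient). -/
noncomputable def charCoeff {n : ℕ} (M : Matrix (Fin n) (Fin n) ℤ) (k : ℕ) : ℤ :=
  if k ≤ n then M.charpoly.coeff (n - k) else 0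

/-- The set of tuples `(a_2, a_3, …, a_e)` modulo `2 ^ e`, where `M` runs through `S` and the
`a_k` are the coefficients of the characteristic polynomial of `M`. -/
def residueTuples (e : ℕ) {n : ℕ} (S : Set (Matrix (Fin n) (Fin n) ℤ)) :
    Set (Finset.Icc 2 e → ZMod (2 ^ e)) :=
  {t | ∃ M ∈ S, ∀ k : Finset.Icc 2 e, t k = (charCoeff M (k : ℕ) : ZMod (2 ^ e))}

/-- The set of characteristic polynomials `det (x I - M)` modulo `2 ^ e`, `M` in `S`. -/
def charpolyClasses (e : ℕ) {n : ℕ} (S : Set (Matrix (Fin n) (Fin n) ℤ)) :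
    Set (Polynomial (ZMod (2 ^ e))) :=
  {p | ∃ M ∈ S, p = M.charpoly.map (Int.castRingHom (ZMod (2 ^ e)))}

/-!
Write `M = J - 2A` with `A` the adjacency matrix of a graph and `J` the all-ones matrix. Put
`C(t) = det (1 + tA)` and `D(t) = 1ᵀ adj(1 + tA) 1`, so that `det (1 + tA - xJ) = C - xD`. Then
`det (1 - xM) = C(2x) - x D(2x)`, so `a_k = 2 ^ (k - 1) b_k`, where the `b_k` are the coefficients
of `signPoly A = 2C - tD`. Moreover `a_0 = 1`, `a_1 = -n` and `a_2 = 0`. A class modulo `2 ^ e`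
therefore amounts to the residues of `b_k` modulo `2 ^ (e + 1 - k)` for `3 ≤ k ≤ e`, and the theorem
says that precisely the lowest bits of the `b_k` are not free, except for that of `b_3` when `n` is
odd (`classData` is the free part).

*The lowest bits are determined.* `D` is the determinant of the form `1 + tA` restricted to the
vectors `e_i - e_0`, an even symmetric matrix of size `n - 1` (`onesDefect_eq_det`). If `n` is even,
this matrix has odd size, so `2 ∣ D` and every `b_k` is even. If `n` is odd, it is an even form of
even rank that is unimodular at `t = 0`, and splitting off binary forms gives `D ≡ ± F²` modulo `4`
(`IsEvenSymm.det_eq_neg_one_pow_mul_sq`). As also `C ≡ D` modulo `2`, the parity of `b_{2s+1}` is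
that of `F_s`, which can be read off from `D_s` modulo `4` and the `F_r` with `r < s`, that is, from
earlier `b_k` modulo `4` (`two_mul_eq_of_neg_one_pow_mul_sq`); the `b_k` of even index `k` are even.

*Everything else occurs.* With `W = 1ᵀ (1 + tA)⁻¹ 1` one has `D = C W` and
`signPoly A = C (2 - tW)`. Under disjoint unions `C` is multiplicative and `W` is additive. Modulo
`2 ^ e` and `t ^ (e + 1)` all pairs `(C, W)` have finite order, so unions with negative
multiplicities are available at the cost of more vertices. The virtual graph
`P_{m+1} - 2 P_m + P_{m-1}` built from paths has `C = 1 + O(t ^ (2m))` and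
`W = 2 (-t) ^ m + O(t ^ (m + 1))`: adding a multiple of it changes `b_{m+1}` by any prescribed even
number and no earlier coefficient (`EventuallyAttained.adjust`). Thus the `b_k` can be prescribed one
after the other, up to their lowest bits, and a single edge adjusts the parity of `b_3` for odd `n`.
Isolated vertices fill up the order, which gives all large `n`.
-/

/-! ### Even symmetric matrices -/

section EvenSymmetric

variable {K : Type*} [CommRing K] {ι κ : Type*}

/-- A symmetric matrix is *even* when its diagonal entries are divisible by `2`; equivalently, the
quadratic form `v ↦ vᵀ X v` takes values in the ideal `(2)`. -/
def IsEvenSymm (X : Matrix ι ι K) : Prop := X.IsSymm ∧ ∀ i, 2 ∣ X i i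

theorem two_dvd_sum_sum_of_symm [Fintype ι] (f : ι → ι → K) (hs : ∀ i j, f i j = f j i)
    (hd : ∀ i, 2 ∣ f i i) : 2 ∣ ∑ i, ∑ j, f i j := by
  classical
  suffices h : ∀ s : Finset ι, 2 ∣ ∑ i ∈ s, ∑ j ∈ s, f i j from h Finset.univ
  intro s
  induction s using Finset.induction_on with
  | empty => simp
  | insert a s ha ih =>
    have hsplit : ∑ i ∈ insert a s, ∑ j ∈ insert a s, f i j
        = f a a + 2 * ∑ j ∈ s, f a j + ∑ i ∈ s, ∑ j ∈ s, f i j := by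
      simp only [Finset.sum_insert ha, Finset.sum_add_distrib, fun i => hs i a]
      ring
    rw [hsplit]
    exact dvd_add (dvd_add (hd a) (dvd_mul_right _ _)) ih

/-- Evenness is invariant under a change of variables in the quadratic form. -/
theorem IsEvenSymm.conj [Fintype ι] {X : Matrix ι ι K} (hX : IsEvenSymm X) (P : Matrix ι κ K) :
    IsEvenSymm (P.transpose * X * P) := by
  refine ⟨?_, fun i => ?_⟩
  · have := hX.1.eq
    simp [Matrix.IsSymm, Matrix.transpose_mul, this, Matrix.mul_assoc]
  · have hsum : (P.transpose * X * P) i i = ∑ k, ∑ j, P j i * X j k * P k i := by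
      simp [Matrix.mul_apply, Finset.sum_mul]
    rw [hsum]
    refine two_dvd_sum_sum_of_symm _ (fun j k => ?_) (fun j => ?_)
    · rw [hX.1.apply j k]; ring
    · exact ((hX.2 j).mul_left _).mul_right _

theorem IsEvenSymm.sub {X Y : Matrix ι ι K} (hX : IsEvenSymm X) (hY : IsEvenSymm Y) :
    IsEvenSymm (X - Y) :=
  ⟨hX.1.sub hY.1, fun i => dvd_sub (hX.2 i) (hY.2 i)⟩

theorem IsEvenSymm.submatrix {X : Matrix ι ι K} (hX : IsEvenSymm X) (g : κ → ι) :
    IsEvenSymm (X.submatrix g g) :=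
  ⟨hX.1.submatrix g, fun i => hX.2 (g i)⟩

/-- Modulo `2` an even symmetric matrix is skew-symmetric with zero diagonal. -/
theorem IsEvenSymm.two_dvd_det [IsDomain K] [CharZero K] {n : ℕ} (hn : Odd n)
    {X : Matrix (Fin n) (Fin n) K} (hX : IsEvenSymm X) : 2 ∣ X.det := by
  set Y : Matrix (Fin n) (Fin n) K :=
    Matrix.of fun i j => if i < j then X i j else if j < i then -X i j else 0 with hY
  have hskew : Y.transpose = -Y := by
    ext i j
    rcases lt_trichotomy i j with h | h | h
    · simp [hY, h, h.not_gt, hX.1.apply i j]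
    · simp [hY, h]
    · simp [hY, h, h.not_gt, hX.1.apply i j]
  have hdet : Y.det = 0 := by
    have h1 : Y.det = -Y.det := by
      conv_lhs => rw [← Matrix.det_transpose, hskew, Matrix.det_neg]
      simp [hn.neg_one_pow]
    exact self_eq_neg.mp h1
  set q := Ideal.Quotient.mk (Ideal.span {(2 : K)})
  have hq2 : q 2 = 0 := by
    rw [Ideal.Quotient.eq_zero_iff_mem]; exact Ideal.mem_span_singleton_self _
  have hmap : q.mapMatrix X = q.mapMatrix Y := by
    ext i j
    have hneg : ∀ x : K, q x = - q x := fun x => by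
      have : q (2 * x) = 0 := by rw [map_mul, hq2, zero_mul]
      rw [two_mul, map_add] at this
      exact eq_neg_of_add_eq_zero_left this
    rcases lt_trichotomy i j with h | h | h
    · simp [hY, h]
    · subst h
      obtain ⟨c, hc⟩ := hX.2 i
      simp [hY, hc, hq2]
    · simpa [hY, h, h.not_gt] using hneg _
  have : q X.det = 0 := by rw [RingHom.map_det, hmap, ← RingHom.map_det, hdet, map_zero]
  rwa [Ideal.Quotient.eq_zero_iff_mem, Ideal.mem_span_singleton] at this

/-- The discriminant of an even unimodular form of rank `2m` is `(-1)^m` times a square modulo `4`: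
binary forms `2ax² + 2bxy + 2cy²` with `b` a unit split off one after the other. -/
theorem IsEvenSymm.det_eq_neg_one_pow_mul_sq [IsLocalRing K] (h4 : (4 : K) = 0)
    (h2 : ¬ IsUnit (2 : K)) (m : ℕ) {ι : Type} [Fintype ι] [DecidableEq ι]
    (hι : Fintype.card ι = 2 * m) {X : Matrix ι ι K} (hX : IsEvenSymm X) (hu : IsUnit X.det) :
    ∃ f : K, X.det = (-1) ^ m * f ^ 2 := by
  induction m generalizing ι with
  | zero =>
    have : IsEmpty ι := Fintype.card_eq_zero_iff.mp (by simpa using hι)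
    exact ⟨1, by simp⟩
  | succ m ih =>
    have hcard : Fintype.card (Fin 2 ⊕ Fin (2 * m)) = Fintype.card ι := by
      simp [hι]; ring
    let e₀ : Fin 2 ⊕ Fin (2 * m) ≃ ι := Fintype.equivOfCardEq hcard
    set i := e₀ (Sum.inl 0) with hi
    -- a row of nonunits would make the determinant a nonunit
    obtain ⟨j, hj⟩ : ∃ j, IsUnit (X i j) := by
      by_contra! hno
      have hmem : X.det ∈ IsLocalRing.maximalIdeal K := by
        rw [Matrix.det_apply']
        refine Ideal.sum_mem _ fun σ _ => Ideal.mul_mem_left _ _ ?_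
        refine Ideal.mem_of_dvd _ (Finset.dvd_prod_of_mem _ (Finset.mem_univ (σ.symm i))) ?_
        simpa using hno _
      exact hmem hu
    have hij : i ≠ j := by
      rintro rfl
      obtain ⟨c, hc⟩ := hX.2 i
      rw [hc] at hj
      exact h2 (isUnit_of_mul_isUnit_left hj)
    let e : Fin 2 ⊕ Fin (2 * m) ≃ ι := e₀.trans (Equiv.swap (e₀ (Sum.inl 1)) j)
    have he0 : e (Sum.inl 0) = i := by
      simp only [e, Equiv.trans_apply, ← hi]
      exact Equiv.swap_apply_of_ne_of_ne (by simp [hi]) hij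
    have he1 : e (Sum.inl 1) = j := by simp [e]
    set Y := X.submatrix e e with hYdef
    have hY : IsEvenSymm Y := hX.submatrix e
    have hdetY : Y.det = X.det := Matrix.det_submatrix_equiv_self e X
    set B := Y.toBlocks₁₁
    have hB : IsEvenSymm B := hY.submatrix Sum.inl
    set R := Y.toBlocks₁₂
    have hR : Y.toBlocks₂₁ = R.transpose := by
      ext a b; exact hY.1.apply _ _
    have hdetB : B.det = -(X i j) ^ 2 := by
      obtain ⟨a, ha⟩ := hB.2 0
      obtain ⟨c, hc⟩ := hB.2 1
      have hb : B 0 1 = X i j := by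
        simp [B, Y, Matrix.toBlocks₁₁, he0, he1]
      rw [Matrix.det_fin_two, hB.1.apply 0 1, ha, hc, hb]
      linear_combination (a * c) * h4
    have huB : IsUnit B.det := by rw [hdetB]; exact (hj.pow 2).neg
    let _ := Matrix.invertibleOfIsUnitDet B huB
    have hinv : IsEvenSymm (⅟B) := by
      have hsymm : (⅟B).transpose = ⅟B := by
        rw [Matrix.invOf_eq_nonsing_inv, Matrix.transpose_nonsing_inv, hB.1.eq]
      have h := hB.conj (⅟B)
      rwa [hsymm, invOf_mul_self, Matrix.one_mul] at h
    set S := Y.toBlocks₂₂ - R.transpose * ⅟B * R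
    have hS : IsEvenSymm S := (hY.submatrix Sum.inr).sub (hinv.conj R)
    have hdet : X.det = B.det * S.det := by
      rw [← hdetY, ← Matrix.fromBlocks_toBlocks Y, hR, Matrix.det_fromBlocks₁₁]
    obtain ⟨f, hf⟩ := ih (ι := Fin (2 * m)) (by simp) hS
      (isUnit_of_mul_isUnit_right (hdet ▸ hu))
    refine ⟨X i j * f, ?_⟩
    rw [hdet, hdetB, hf]
    ring

end EvenSymmetric

/-! ### Subtracting a multiple of the all-ones matrix -/

section AllOnes

variable {K : Type*} [CommRing K]

/-- The Gram matrix, on the vectors `e_i - e_0` (`i ≥ 1`), of the bilinear form with matrix `N`. -/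
def hyperplaneGram {m : ℕ} (N : Matrix (Fin (m + 1)) (Fin (m + 1)) K) :
    Matrix (Fin m) (Fin m) K :=
  Matrix.of fun i j => N i.succ j.succ - N i.succ 0 - N 0 j.succ + N 0 0

/-- The Gram matrix, on `e_0` and the vectors `e_i - e_0` (`i ≥ 1`), of the bilinear form with
matrix `N`, except that the value at `(e_0, e_0)` is replaced by `a`. -/
def corneredGram {m : ℕ} (N : Matrix (Fin (m + 1)) (Fin (m + 1)) K) (a : K) :
    Matrix (Fin (m + 1)) (Fin (m + 1)) K :=
  Matrix.of <| Fin.cons (Fin.cons a fun j => N 0 j.succ - N 0 0)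
    fun i => Fin.cons (N i.succ 0 - N 0 0) fun j => hyperplaneGram N i j

/-- Passing from the `e_i` to `e_0` and the `e_i - e_0` is a unimodular change of basis. -/
theorem det_corneredGram_self {m : ℕ} (N : Matrix (Fin (m + 1)) (Fin (m + 1)) K) :
    (corneredGram N (N 0 0)).det = N.det := by
  set N' : Matrix (Fin (m + 1)) (Fin (m + 1)) K :=
    Matrix.of fun i j => N i j - (if j = 0 then 0 else 1) * N i 0 with hN'
  have h1 : N.det = N'.det := by
    rw [← Matrix.det_transpose N, ← Matrix.det_transpose N']
    refine Matrix.det_eq_of_forall_row_eq_smul_add_const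
      (fun j => if j = 0 then 0 else 1) 0 (by simp) fun i j => ?_
    simp [hN']
  have h2 : N'.det = (corneredGram N (N 0 0)).det := by
    refine Matrix.det_eq_of_forall_row_eq_smul_add_const
      (fun j => if j = 0 then 0 else 1) 0 (by simp) fun i j => ?_
    refine Fin.cases ?_ (fun i => ?_) i <;> refine Fin.cases ?_ (fun j => ?_) j <;>
      simp [hN', corneredGram, hyperplaneGram]
  rw [h1, h2]

theorem det_corneredGram {m : ℕ} (N : Matrix (Fin (m + 1)) (Fin (m + 1)) K) (a : K) :
    (corneredGram N a).det = a * (hyperplaneGram N).det + (corneredGram N 0).det := by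
  rw [Matrix.det_succ_row_zero, Matrix.det_succ_row_zero (corneredGram N 0), Fin.sum_univ_succ,
    Fin.sum_univ_succ]
  have hsub : (corneredGram N a).submatrix Fin.succ (Fin.succAbove 0) = hyperplaneGram N := by
    ext i j; simp [corneredGram]
  have hrow : ∀ j : Fin m, (corneredGram N a).submatrix Fin.succ (Fin.succAbove j.succ)
      = (corneredGram N 0).submatrix Fin.succ (Fin.succAbove j.succ) := fun j => by
    ext i k; simp [corneredGram]
  rw [hsub]
  simp only [hrow]
  simp [corneredGram]

/-- The all-ones matrix. -/
abbrev onesMatrix (ι K : Type*) [One K] : Matrix ι ι K := Matrix.of fun _ _ => 1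

theorem det_sub_smul_ones_succ {m : ℕ} (N : Matrix (Fin (m + 1)) (Fin (m + 1)) K) (x : K) :
    (N - x • onesMatrix _ K).det
      = (N 0 0 - x) * (hyperplaneGram N).det + (corneredGram N 0).det := by
  have hZ : hyperplaneGram (N - x • onesMatrix _ K) = hyperplaneGram N := by
    ext i j
    simp [hyperplaneGram]
    ring
  have hB : corneredGram (N - x • onesMatrix _ K) 0 = corneredGram N 0 := by
    ext i j
    refine Fin.cases ?_ (fun i => ?_) i <;> refine Fin.cases ?_ (fun j => ?_) j
    · rfl
    · simp [corneredGram]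
    · simp [corneredGram]
    · exact congrFun₂ hZ i j
  rw [← det_corneredGram_self, det_corneredGram, hZ, hB]
  simp

theorem det_sub_det_sub_ones_succ {m : ℕ} (N : Matrix (Fin (m + 1)) (Fin (m + 1)) K) :
    N.det - (N - onesMatrix _ K).det = (hyperplaneGram N).det := by
  have h0 := det_sub_smul_ones_succ N 0
  have h1 := det_sub_smul_ones_succ N 1
  rw [zero_smul, sub_zero] at h0
  rw [one_smul] at h1
  rw [h0, h1]
  ring

/-- `det (N - x J)` is an affine function of `x`. -/
theorem det_sub_smul_ones {n : ℕ} (N : Matrix (Fin n) (Fin n) K) (x : K) :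
    (N - x • onesMatrix _ K).det = N.det - x * (N.det - (N - onesMatrix _ K).det) := by
  cases n with
  | zero => simp
  | succ m =>
    have h0 := det_sub_smul_ones_succ N 0
    rw [zero_smul, sub_zero] at h0
    rw [det_sub_det_sub_ones_succ, det_sub_smul_ones_succ, h0]
    ring

end AllOnes

/-! ### Coefficients of squares modulo `4` -/

section SquaresModFour

open PowerSeries

theorem two_mul_coeff_sq (F : (ZMod 4)⟦X⟧) (s : ℕ) :
    2 * coeff (2 * s) (F ^ 2) = 2 * coeff s F := by
  have hx : ∀ x : ZMod 4, 2 * (x * x) = 2 * x := by decide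
  rw [pow_two, coeff_mul, Finset.mul_sum, ← Finset.add_sum_erase _ _ (a := (s, s))
    (by rw [Finset.HasAntidiagonal.mem_antidiagonal]; omega), hx, add_eq_left]
  refine Finset.sum_involution (fun p _ => p.swap) (fun p _ => ?_) (fun p hp _ heq => ?_)
    (fun p hp => ?_) (fun p _ => p.swap_swap)
  · have h4 : (4 : ZMod 4) = 0 := rfl
    simp only [Prod.fst_swap, Prod.snd_swap]
    linear_combination (coeff p.1 F * coeff p.2 F) * h4
  · rw [Finset.mem_erase, Finset.HasAntidiagonal.mem_antidiagonal] at hp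
    have h1 : p.2 = p.1 := congrArg Prod.fst heq
    exact hp.1 (Prod.ext (by omega) (by omega))
  · rw [Finset.mem_erase, Finset.HasAntidiagonal.mem_antidiagonal] at hp ⊢
    refine ⟨fun heq => hp.1 ?_, by simpa [add_comm] using hp.2⟩
    rw [← p.swap_swap, heq]; rfl

theorem two_mul_coeff_sq_of_odd (F : (ZMod 4)⟦X⟧) {k : ℕ} (hk : Odd k) :
    2 * coeff k (F ^ 2) = 0 := by
  rw [pow_two, coeff_mul, Finset.mul_sum]
  refine Finset.sum_involution (fun p _ => p.swap) (fun p _ => ?_) (fun p hp _ heq => ?_)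
    (fun p hp => ?_) (fun p _ => p.swap_swap)
  · have h4 : (4 : ZMod 4) = 0 := rfl
    simp only [Prod.fst_swap, Prod.snd_swap]
    linear_combination (coeff p.1 F * coeff p.2 F) * h4
  · rw [Finset.HasAntidiagonal.mem_antidiagonal] at hp
    have h1 : p.2 = p.1 := congrArg Prod.fst heq
    obtain ⟨r, hr⟩ := hk
    omega
  · rw [Finset.HasAntidiagonal.mem_antidiagonal] at hp ⊢
    simpa [add_comm] using hp

theorem coeff_sq_eq_zero_of_even_lower (Δ : (ZMod 4)⟦X⟧) {s : ℕ} (hs : 1 ≤ s)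
    (h : ∀ r < s, 2 * coeff r Δ = 0) : coeff s (Δ ^ 2) = 0 := by
  have hmul : ∀ x y : ZMod 4, 2 * x = 0 → 2 * y = 0 → x * y = 0 := by decide
  rw [pow_two, coeff_mul]
  obtain rfl | ⟨s, rfl⟩ : s = 1 ∨ ∃ s', s = s' + 2 := by
    rcases s with _ | _ | s
    · omega
    · exact Or.inl rfl
    · exact Or.inr ⟨s, rfl⟩
  · have := h 0 (by omega)
    rw [show Finset.HasAntidiagonal.antidiagonal 1 = {(0, 1), (1, 0)} from rfl,
      Finset.sum_pair (by decide)]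
    linear_combination (coeff 1 Δ) * this
  · have h0 := h 0 (by omega)
    rw [Finset.Nat.antidiagonal_succ_succ']
    simp only [Finset.sum_cons, Finset.sum_map, Function.Embedding.prodMap,
      Function.Embedding.coeFn_mk, Prod.map_fst, Prod.map_snd]
    rw [Finset.sum_eq_zero]
    · linear_combination (coeff (s + 2) Δ) * h0
    · intro p hp
      rw [Finset.HasAntidiagonal.mem_antidiagonal] at hp
      exact hmul _ _ (h _ (by simp; omega)) (h _ (by simp; omega))

/-- A coefficient of `F` is determined modulo `2` by the coefficients of smaller index modulo `2`
and the coefficient of `F²` of the same index modulo `4`. -/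
theorem two_mul_coeff_eq_of_sq {F F' : (ZMod 4)⟦X⟧} {s : ℕ} (hs : 1 ≤ s)
    (h0 : 2 * coeff 0 F' = 2) (h : ∀ r < s, 2 * coeff r F = 2 * coeff r F')
    (hsq : coeff s (F ^ 2) = coeff s (F' ^ 2)) : 2 * coeff s F = 2 * coeff s F' := by
  have hΔ : ∀ r < s, 2 * coeff r (F - F') = 0 := fun r hr => by
    rw [map_sub, mul_sub, h r hr, sub_self]
  have hcross : coeff s (2 * (F - F') * F') = 2 * coeff s (F - F') := by
    have h2 : (2 : (ZMod 4)⟦X⟧) = C 2 := rfl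
    rw [coeff_mul, Finset.sum_eq_single (s, 0)]
    · rw [h2, coeff_C_mul]
      have hx : ∀ x y : ZMod 4, 2 * y = 2 → 2 * x * y = 2 * x := by decide
      exact hx _ _ h0
    · intro p hp hne
      rw [Finset.HasAntidiagonal.mem_antidiagonal] at hp
      have : p.1 < s := by
        rcases p with ⟨a, b⟩
        simp only [ne_eq, Prod.mk.injEq, not_and] at hne hp ⊢
        by_contra hlt
        exact hne (by omega) (by omega)
      rw [h2, coeff_C_mul, hΔ _ this, zero_mul]
    · simp
  have hexp : F ^ 2 - F' ^ 2 = (F - F') ^ 2 + 2 * (F - F') * F' := by ring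
  have := congrArg (coeff s) hexp
  rw [map_sub, hsq, sub_self, map_add, coeff_sq_eq_zero_of_even_lower _ hs hΔ, zero_add, hcross,
    map_sub, mul_sub] at this
  exact sub_eq_zero.mp this.symm

/-- If `D` is `±` a square, then the sequence `2 D_k - D_{k-1}` determines its own parities: the
parity at `2s + 1` is that of the coefficient of index `s` of the square root, which can be read
off from `D_s` and the coefficients of smaller index. -/
theorem two_mul_eq_of_neg_one_pow_mul_sq {m : ℕ} {D D' F F' : (ZMod 4)⟦X⟧}
    (hD : D = (-1) ^ m * F ^ 2) (hD' : D' = (-1) ^ m * F' ^ 2)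
    (h0 : 2 * coeff 0 D' = 2) {k : ℕ} (hk : 3 ≤ k)
    (h : ∀ j < k, 2 * coeff (j + 1) D - coeff j D = 2 * coeff (j + 1) D' - coeff j D') :
    2 * coeff k D = 2 * coeff k D' := by
  have hcoeff : ∀ (G : (ZMod 4)⟦X⟧) (j : ℕ), coeff j ((-1) ^ m * G) = (-1) ^ m * coeff j G := by
    intro G j
    rcases neg_one_pow_eq_or (ZMod 4)⟦X⟧ m with h1 | h1 <;>
      rcases Nat.even_or_odd m with h2 | h2 <;> simp [h2.neg_one_pow]
  have htwo : ∀ x : ZMod 4, 2 * ((-1) ^ m * x) = 2 * x := by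
    have : ∀ x : ZMod 4, 2 * (-x) = 2 * x := by decide
    intro x
    rcases Nat.even_or_odd m with h2 | h2 <;> simp only [h2.neg_one_pow, one_mul, neg_one_mul, this]
  have htwo' : ∀ x y z w : ZMod 4, 2 * x - y = 2 * z - w → 2 * y = 2 * w := by decide
  have hpar : ∀ j < k, 2 * coeff j D = 2 * coeff j D' := fun j hj => htwo' _ _ _ _ (h j hj)
  have hroot : ∀ s, 2 * coeff (2 * s) D = 2 * coeff s F := fun s => by
    rw [hD, hcoeff, htwo, two_mul_coeff_sq]
  have hroot' : ∀ s, 2 * coeff (2 * s) D' = 2 * coeff s F' := fun s => by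
    rw [hD', hcoeff, htwo, two_mul_coeff_sq]
  obtain ⟨s, rfl | rfl⟩ := Nat.even_or_odd' k
  · rw [hroot, hroot']
    refine two_mul_coeff_eq_of_sq (by omega) (by rw [← hroot', mul_zero, h0])
      (fun r hr => by rw [← hroot, ← hroot', hpar _ (by omega)]) ?_
    have hDs : coeff s D = coeff s D' := by
      have h1 := h s (by omega)
      rw [hpar (s + 1) (by omega)] at h1
      exact sub_right_injective h1
    rw [hD, hD', hcoeff, hcoeff] at hDs
    exact (isUnit_one.neg.pow m).mul_left_cancel hDs
  · rw [hD, hD', hcoeff, hcoeff, htwo, htwo, two_mul_coeff_sq_of_odd _ ⟨s, rfl⟩,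
      two_mul_coeff_sq_of_odd _ ⟨s, rfl⟩]

end SquaresModFour

/-! ### The characteristic polynomial of `J - 2A` -/

section SignPolynomial

open Polynomial

/-- The pencil `1 + t A`. -/
noncomputable def pencil {ι R : Type*} [DecidableEq ι] [CommRing R] (A : Matrix ι ι R) :
    Matrix ι ι R[X] :=
  1 + (X : R[X]) • A.map C

/-- `det (1 + t A) - det (1 + t A - J)`, that is `1ᵀ adj(1 + t A) 1`. -/
noncomputable def onesDefect {n : ℕ} (A : Matrix (Fin n) (Fin n) ℤ) : ℤ[X] :=
  (pencil A).det - (pencil A - onesMatrix _ _).det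

/-- The polynomial `2 C(t) - t D(t)` with `C = det (1 + t A)` and `D = 1ᵀ adj(1 + t A) 1`.
For `M = J - 2A` it is twice the reversed characteristic polynomial of `M`, evaluated at `t / 2`. -/
noncomputable def signPoly {n : ℕ} (A : Matrix (Fin n) (Fin n) ℤ) : ℤ[X] :=
  2 * (pencil A).det - X * onesDefect A

variable {n : ℕ} {A : Matrix (Fin n) (Fin n) ℤ}

theorem charCoeff_eq_coeff_charpolyRev (M : Matrix (Fin n) (Fin n) ℤ) (k : ℕ) :
    charCoeff M k = M.charpolyRev.coeff k := by
  have hdeg : M.charpoly.natDegree = n := by simp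
  rw [← M.reverse_charpoly, coeff_reverse, hdeg, charCoeff]
  split_ifs with h
  · rw [revAt_le h]
  · rw [revAt_eq_self_of_lt (by omega), coeff_eq_zero_of_natDegree_lt (by omega)]

theorem charpolyRev_ones_sub (A : Matrix (Fin n) (Fin n) ℤ) :
    (onesMatrix _ ℤ - (2 : ℤ) • A).charpolyRev
      = (pencil A).det.comp (C 2 * X) - X * (onesDefect A).comp (C 2 * X) := by
  set φ : ℤ[X] →+* ℤ[X] := compRingHom (C 2 * X) with hφ
  have hφa : ∀ p, p.comp (C 2 * X) = φ p := fun p => rfl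
  have hones : φ.mapMatrix (onesMatrix (Fin n) ℤ[X]) = onesMatrix _ _ := by
    ext i j; simp [onesMatrix]
  have hM : (1 - (X : ℤ[X]) • (onesMatrix (Fin n) ℤ - (2 : ℤ) • A).map C)
      = φ.mapMatrix (pencil A) - (X : ℤ[X]) • onesMatrix _ _ := by
    refine Matrix.ext fun i j => ?_
    have hij : (onesMatrix (Fin n) ℤ - (2 : ℤ) • A) i j = 1 - 2 * A i j := rfl
    rw [Matrix.sub_apply, Matrix.smul_apply, Matrix.map_apply, hij]
    by_cases h : i = j <;> simp [pencil, hφ, h, onesMatrix, Matrix.one_apply] <;> ring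
  rw [Matrix.charpolyRev, hM, det_sub_smul_ones, hφa, hφa, onesDefect, map_sub, RingHom.map_det,
    RingHom.map_det, map_sub, hones]

/-- The coefficients satisfy `a_k = 2 ^ (k - 1) b_k`. -/
theorem charCoeff_ones_sub_succ (A : Matrix (Fin n) (Fin n) ℤ) (k : ℕ) :
    charCoeff (onesMatrix _ ℤ - (2 : ℤ) • A) (k + 1) = 2 ^ k * (signPoly A).coeff (k + 1) := by
  have h2 : (2 : ℤ[X]) = C 2 := rfl
  rw [charCoeff_eq_coeff_charpolyRev, charpolyRev_ones_sub, coeff_sub, coeff_X_mul,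
    comp_C_mul_X_coeff, comp_C_mul_X_coeff, signPoly, coeff_sub, coeff_X_mul, h2, coeff_C_mul]
  ring

theorem coeff_signPoly_succ (A : Matrix (Fin n) (Fin n) ℤ) (k : ℕ) :
    (signPoly A).coeff (k + 1) = 2 * (pencil A).det.coeff (k + 1) - (onesDefect A).coeff k := by
  have h2 : (2 : ℤ[X]) = C 2 := rfl
  rw [signPoly, coeff_sub, coeff_X_mul, h2, coeff_C_mul]

theorem charCoeff_zero (M : Matrix (Fin n) (Fin n) ℤ) : charCoeff M 0 = 1 := by
  rw [charCoeff_eq_coeff_charpolyRev, coeff_zero_eq_eval_zero, Matrix.eval_charpolyRev]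

theorem charCoeff_one {M : Matrix (Fin n) (Fin n) ℤ} (hM : M ∈ symmSignMatrices n) :
    charCoeff M 1 = -n := by
  rw [charCoeff_eq_coeff_charpolyRev, Matrix.coeff_charpolyRev_eq_neg_trace]
  simp [Matrix.trace, hM.2.2]

/-- The principal `2 × 2` minors vanish. -/
theorem charCoeff_two {M : Matrix (Fin n) (Fin n) ℤ} (hM : M ∈ symmSignMatrices n) :
    charCoeff M 2 = 0 := by
  have hneg : M.charpolyRev = (1 + (X : ℤ[X]) • (-M).map C).det := by
    rw [Matrix.charpolyRev]
    congr 1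
    ext1 i j
    simp [sub_eq_add_neg]
  rw [charCoeff_eq_coeff_charpolyRev, hneg, Matrix.coeff_det_one_add_X_smul_eq_sum_minors]
  refine Finset.sum_eq_zero fun s hs => ?_
  rw [Finset.mem_powersetCard] at hs
  have e : Fin 2 ≃ s := Fintype.equivOfCardEq (by simp [hs.2])
  rw [← Matrix.det_submatrix_equiv_self e, Matrix.det_fin_two]
  simp only [Matrix.submatrix_apply, Matrix.neg_apply, hM.2.2]
  have hsymm : M (e 1) (e 0) = M (e 0) (e 1) := congrFun₂ hM.2.1 _ _
  rw [hsymm]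
  rcases hM.1 (e 0) (e 1) with h | h <;> rw [h] <;> norm_num

/-! ### Parities of the coefficients -/

theorem pencil_isSymm (hA : A.IsSymm) : (pencil A).IsSymm :=
  Matrix.isSymm_one.add ((hA.map C).smul X)

theorem pencil_apply_self (hd : ∀ i, A i i = 0) (i : Fin n) : pencil A i i = 1 := by
  simp [pencil, hd]

section Succ

variable {m : ℕ} {A : Matrix (Fin (m + 1)) (Fin (m + 1)) ℤ}

theorem isEvenSymm_hyperplaneGram (hA : A.IsSymm) (hd : ∀ i, A i i = 0) :
    IsEvenSymm (hyperplaneGram (pencil A)) := by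
  have hs := pencil_isSymm hA
  refine ⟨Matrix.IsSymm.ext fun i j => ?_, fun i => ⟨1 - pencil A 0 i.succ, ?_⟩⟩
  · simp only [hyperplaneGram, Matrix.of_apply]
    rw [hs.apply i.succ j.succ, hs.apply 0 j.succ, hs.apply i.succ 0]
    ring
  · simp only [hyperplaneGram, Matrix.of_apply, pencil_apply_self hd]
    rw [hs.apply 0 i.succ]
    ring

theorem isEvenSymm_corneredGram (hA : A.IsSymm) (hd : ∀ i, A i i = 0) :
    IsEvenSymm (corneredGram (pencil A) 0) := by
  have hs := pencil_isSymm hA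
  have hZ := isEvenSymm_hyperplaneGram hA hd
  refine ⟨Matrix.IsSymm.ext fun i j => ?_, fun i => ?_⟩
  · refine Fin.cases ?_ (fun i => ?_) i <;> refine Fin.cases ?_ (fun j => ?_) j
    · rfl
    · simp [corneredGram, hs.apply 0 j.succ]
    · simp [corneredGram, hs.apply i.succ 0]
    · exact hZ.1.apply i j
  · refine Fin.cases ?_ (fun i => ?_) i
    · simp [corneredGram]
    · exact hZ.2 i

theorem onesDefect_eq_det (A : Matrix (Fin (m + 1)) (Fin (m + 1)) ℤ) :
    onesDefect A = (hyperplaneGram (pencil A)).det :=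
  det_sub_det_sub_ones_succ _

/-- The corner entry of the Gram matrix of `1 + tA` on `e_0` and the `e_i - e_0` is `1`. -/
theorem det_pencil_eq (hd : ∀ i, A i i = 0) :
    (pencil A).det = onesDefect A + (corneredGram (pencil A) 0).det := by
  rw [onesDefect_eq_det, ← det_corneredGram_self, det_corneredGram, pencil_apply_self hd, one_mul]

end Succ

theorem two_dvd_coeff_signPoly (hn : Even n) (hA : A.IsSymm) (hd : ∀ i, A i i = 0) (k : ℕ) :
    2 ∣ (signPoly A).coeff k := by
  have h2 : (2 : ℤ[X]) ∣ signPoly A := by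
    rw [signPoly]
    refine dvd_sub (dvd_mul_right _ _) (Dvd.dvd.mul_left ?_ _)
    rcases n with _ | m
    · simp [onesDefect]
    · rw [onesDefect_eq_det]
      exact (isEvenSymm_hyperplaneGram hA hd).two_dvd_det
        (by rwa [Nat.even_add_one, Nat.not_even_iff_odd] at hn)
  obtain ⟨q, hq⟩ := h2
  rw [hq, show (2 : ℤ[X]) = C 2 from rfl, coeff_C_mul]
  exact dvd_mul_right _ _

theorem two_dvd_det_pencil_sub (hn : Odd n) (hA : A.IsSymm) (hd : ∀ i, A i i = 0) :
    2 ∣ (pencil A).det - onesDefect A := by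
  rcases n with _ | m
  · simp at hn
  · rw [det_pencil_eq hd, add_sub_cancel_left]
    exact (isEvenSymm_corneredGram hA hd).two_dvd_det hn

/-- At `t = 0` the defect is `1ᵀ 1 = n`. -/
theorem coeff_zero_onesDefect (hM : onesMatrix _ ℤ - (2 : ℤ) • A ∈ symmSignMatrices n)
    (hd : ∀ i, A i i = 0) : (onesDefect A).coeff 0 = n := by
  have h1 := charCoeff_one hM
  have h2 := charCoeff_ones_sub_succ A 0
  have h3 := coeff_signPoly_succ A 0
  have h4 : (pencil A).det.coeff 1 = 0 := by
    rw [pencil, Matrix.coeff_det_one_add_X_smul_one]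
    simp [Matrix.trace, hd]
  rw [zero_add] at h2 h3
  rw [h4] at h3
  linarith

theorem isLocalRing_powerSeries_zmod_four : IsLocalRing (PowerSeries (ZMod 4)) := by
  have : Nontrivial (ZMod 4) := ⟨0, 1, by decide⟩
  refine IsLocalRing.of_isUnit_or_isUnit_one_sub_self fun a => ?_
  rw [PowerSeries.isUnit_iff_constantCoeff, PowerSeries.isUnit_iff_constantCoeff, map_sub, map_one]
  generalize PowerSeries.constantCoeff a = x
  revert x
  decide

/-- Reduction of integer polynomials to power series modulo `r`. -/
noncomputable def reduceSeries (r : ℕ) : ℤ[X] →+* PowerSeries (ZMod r) :=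
  Polynomial.coeToPowerSeries.ringHom.comp (mapRingHom (Int.castRingHom (ZMod r)))

@[simp]
theorem coeff_reduceSeries (r : ℕ) (p : ℤ[X]) (k : ℕ) :
    PowerSeries.coeff k (reduceSeries r p) = (p.coeff k : ZMod r) := by
  simp [reduceSeries]

theorem exists_onesDefect_eq_sq {m : ℕ} {A : Matrix (Fin n) (Fin n) ℤ} (hn : n = 2 * m + 1)
    (hA : A.IsSymm) (hd : ∀ i, A i i = 0) (hM : onesMatrix _ ℤ - (2 : ℤ) • A ∈ symmSignMatrices n) :
    ∃ F, reduceSeries 4 (onesDefect A) = (-1) ^ m * F ^ 2 := by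
  subst hn
  have hloc := isLocalRing_powerSeries_zmod_four
  have hZ := isEvenSymm_hyperplaneGram hA hd
  set Z := hyperplaneGram (pencil A)
  set ψ := reduceSeries 4
  have hZ' : IsEvenSymm (ψ.mapMatrix Z) := by
    refine ⟨hZ.1.map ψ, fun i => ?_⟩
    have := map_dvd ψ (hZ.2 i)
    rwa [map_ofNat] at this
  have hdet : ψ (onesDefect A) = (ψ.mapMatrix Z).det := by
    rw [onesDefect_eq_det, RingHom.map_det]
  have hu : IsUnit (ψ.mapMatrix Z).det := by
    rw [← hdet, PowerSeries.isUnit_iff_constantCoeff, ← PowerSeries.coeff_zero_eq_constantCoeff_apply,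
      coeff_reduceSeries, coeff_zero_onesDefect hM hd]
    have : IsUnit (((2 * m + 1 : ℕ) : ZMod 4)) := by
      rw [ZMod.isUnit_iff_coprime]
      exact (Nat.coprime_pow_right_iff (n := 2) (by norm_num) _ 2).mpr (by simp)
    exact_mod_cast this
  have h4 : (4 : PowerSeries (ZMod 4)) = 0 := by
    have : (4 : PowerSeries (ZMod 4)) = PowerSeries.C 4 := rfl
    rw [this, show (4 : ZMod 4) = 0 from rfl, map_zero]
  have h2 : ¬ IsUnit (2 : PowerSeries (ZMod 4)) := by
    rw [PowerSeries.isUnit_iff_constantCoeff, map_ofNat]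
    decide
  rw [hdet]
  exact hZ'.det_eq_neg_one_pow_mul_sq h4 h2 m (by simp) hu

/-- In odd order the parity of a coefficient of `signPoly` beyond the third is determined by the
preceding coefficients modulo `4`. -/
theorem coeff_signPoly_modEq_two {A' : Matrix (Fin n) (Fin n) ℤ} (hn : Odd n)
    (hA : A.IsSymm) (hd : ∀ i, A i i = 0) (hM : onesMatrix _ ℤ - (2 : ℤ) • A ∈ symmSignMatrices n)
    (hA' : A'.IsSymm) (hd' : ∀ i, A' i i = 0)
    (hM' : onesMatrix _ ℤ - (2 : ℤ) • A' ∈ symmSignMatrices n) {k : ℕ} (hk : 4 ≤ k)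
    (h : ∀ j, 1 ≤ j → j < k → (signPoly A).coeff j ≡ (signPoly A').coeff j [ZMOD 4]) :
    (signPoly A).coeff k ≡ (signPoly A').coeff k [ZMOD 2] := by
  obtain ⟨m, hm⟩ := id hn
  obtain ⟨F, hF⟩ := exists_onesDefect_eq_sq hm hA hd hM
  obtain ⟨F', hF'⟩ := exists_onesDefect_eq_sq hm hA' hd' hM'
  obtain ⟨k, rfl⟩ : ∃ k', k = k' + 1 := ⟨k - 1, by omega⟩
  -- modulo 4, `signPoly` has coefficients `2 D_{k+1} - D_k`, since `C ≡ D` modulo 2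
  have key : ∀ {B : Matrix (Fin n) (Fin n) ℤ}, B.IsSymm → (∀ i, B i i = 0) → ∀ j,
      (((signPoly B).coeff (j + 1) : ℤ) : ZMod 4)
        = 2 * PowerSeries.coeff (j + 1) (reduceSeries 4 (onesDefect B))
          - PowerSeries.coeff j (reduceSeries 4 (onesDefect B)) := by
    intro B hB hBd j
    obtain ⟨q, hq⟩ := two_dvd_det_pencil_sub hn hB hBd
    have hC : (pencil B).det.coeff (j + 1) = (onesDefect B).coeff (j + 1) + 2 * q.coeff (j + 1) := by
      rw [sub_eq_iff_eq_add'.mp hq, coeff_add, show (2 : ℤ[X]) = C 2 from rfl, coeff_C_mul]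
    have h4 : (4 : ZMod 4) = 0 := rfl
    rw [coeff_signPoly_succ, hC, coeff_reduceSeries, coeff_reduceSeries]
    push_cast
    linear_combination (q.coeff (j + 1) : ZMod 4) * h4
  have h0 : 2 * PowerSeries.coeff 0 (reduceSeries 4 (onesDefect A')) = 2 := by
    rw [coeff_reduceSeries, coeff_zero_onesDefect hM' hd', hm]
    push_cast
    have h4 : (4 : ZMod 4) = 0 := rfl
    linear_combination (m : ZMod 4) * h4
  have hmain := two_mul_eq_of_neg_one_pow_mul_sq hF hF' h0 (k := k) (by omega) fun j hj => by
    rw [← key hA hd, ← key hA' hd', ZMod.intCast_eq_intCast_iff]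
    exact h _ (by omega) (by omega)
  have hx : ∀ x y z w : ZMod 4, 2 * x = 2 * y → 2 * (2 * z - x) = 2 * (2 * w - y) := by decide
  have hfin : ((2 * (signPoly A).coeff (k + 1) : ℤ) : ZMod 4)
      = ((2 * (signPoly A').coeff (k + 1) : ℤ) : ZMod 4) := by
    push_cast
    rw [key hA hd, key hA' hd']
    exact hx _ _ _ _ hmain
  rw [ZMod.intCast_eq_intCast_iff] at hfin
  have := hfin.dvd
  refine (Int.modEq_iff_dvd).mpr ?_
  push_cast at this
  omega

end SignPolynomial

/-! ### Walk series of graphs -/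

section WalkSeries

open PowerSeries

variable {q : ℕ} {ι κ : Type} [DecidableEq ι] [DecidableEq κ]

/-- The matrix `1 + t A` over the power series modulo `q`. -/
noncomputable def walkMatrix (q : ℕ) (A : Matrix ι ι ℤ) : Matrix ι ι (ZMod q)⟦X⟧ :=
  1 + (X : (ZMod q)⟦X⟧) • A.map (Int.cast : ℤ → (ZMod q)⟦X⟧)

/-- The adjacency matrix of a simple graph, as an integer matrix. -/
structure IsAdjacency (A : Matrix ι ι ℤ) : Prop where
  symm : A.IsSymm
  diag : ∀ i, A i i = 0
  entry : ∀ i j, A i j = 0 ∨ A i j = 1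

/-- `C = det (1 + t A)` and `W = 1ᵀ (1 + t A)⁻¹ 1`. The inverse is avoided by naming the solution
`v` of `(1 + t A) v = 1`. -/
def IsWalkPairOf [Fintype ι] (A : Matrix ι ι ℤ) (C W : (ZMod q)⟦X⟧) : Prop :=
  (walkMatrix q A).det = C ∧ ∃ v, (walkMatrix q A).mulVec v = (fun _ => 1) ∧ ∑ i, v i = W

/-- `C` and `W` are the determinant and the walk series of a graph with `n` vertices. -/
def IsWalkPair (n : ℕ) (C W : (ZMod q)⟦X⟧) : Prop :=
  ∃ A : Matrix (Fin n) (Fin n) ℤ, IsAdjacency A ∧ IsWalkPairOf A C W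

theorem walkMatrix_isSymm {A : Matrix ι ι ℤ} (hA : A.IsSymm) : (walkMatrix q A).IsSymm :=
  Matrix.isSymm_one.add ((hA.map _).smul X)

theorem walkMatrix_submatrix (A : Matrix ι ι ℤ) (f : κ ≃ ι) :
    walkMatrix q (A.submatrix f f) = (walkMatrix q A).submatrix f f := by
  ext i j : 2
  simp [walkMatrix, Matrix.one_apply]

theorem IsWalkPairOf.isWalkPair [Fintype ι] {A : Matrix ι ι ℤ} (hA : IsAdjacency A)
    {C W : (ZMod q)⟦X⟧}
    (h : IsWalkPairOf A C W) {n : ℕ} (hn : Fintype.card ι = n) : IsWalkPair n C W := by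
  obtain ⟨hC, v, hv, hW⟩ := h
  let f : Fin n ≃ ι := Fintype.equivOfCardEq (by simp [hn])
  refine ⟨A.submatrix f f, ⟨hA.symm.submatrix f, fun i => hA.diag _, fun i j => hA.entry _ _⟩,
    ?_, v ∘ f, ?_, ?_⟩
  · rw [walkMatrix_submatrix, Matrix.det_submatrix_equiv_self, hC]
  · rw [walkMatrix_submatrix, Matrix.submatrix_mulVec_equiv]
    rw [Function.comp_assoc, f.self_comp_symm, Function.comp_id, hv]
    rfl
  · rw [← hW]
    exact Equiv.sum_comp f v

theorem walkMatrix_fromBlocks (A : Matrix ι ι ℤ) (B : Matrix ι κ ℤ) (C : Matrix κ ι ℤ)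
    (D : Matrix κ κ ℤ) :
    walkMatrix q (Matrix.fromBlocks A B C D)
      = Matrix.fromBlocks (walkMatrix q A) ((X : (ZMod q)⟦X⟧) • B.map Int.cast)
          ((X : (ZMod q)⟦X⟧) • C.map Int.cast) (walkMatrix q D) := by
  rw [walkMatrix, Matrix.fromBlocks_map, Matrix.fromBlocks_smul, ← Matrix.fromBlocks_one,
    Matrix.fromBlocks_add, zero_add, zero_add, walkMatrix, walkMatrix]

/-- Disjoint unions multiply the determinants and add the walk series. -/
theorem IsWalkPair.union {m n : ℕ} {C W C' W' : (ZMod q)⟦X⟧} (h : IsWalkPair m C W)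
    (h' : IsWalkPair n C' W') : IsWalkPair (m + n) (C * C') (W + W') := by
  obtain ⟨A, hA, hC, v, hv, hW⟩ := h
  obtain ⟨A', hA', hC', v', hv', hW'⟩ := h'
  have hAA : IsAdjacency (Matrix.fromBlocks A 0 0 A') := by
    refine ⟨Matrix.IsSymm.fromBlocks hA.symm (by simp) hA'.symm, ?_, ?_⟩
    · rintro (i | i)
      · exact hA.diag i
      · exact hA'.diag i
    · rintro (i | i) (j | j)
      · exact hA.entry i j
      · exact Or.inl rfl
      · exact Or.inl rfl
      · exact hA'.entry i j
  have hS : walkMatrix q (Matrix.fromBlocks A 0 0 A')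
      = Matrix.fromBlocks (walkMatrix q A) 0 0 (walkMatrix q A') := by
    rw [walkMatrix_fromBlocks]
    congr 1 <;> ext i j : 2 <;> simp
  refine IsWalkPairOf.isWalkPair hAA ⟨?_, Sum.elim v v', ?_, ?_⟩ (by simp)
  · rw [hS, Matrix.det_fromBlocks_zero₂₁, hC, hC']
  · rw [hS, Matrix.fromBlocks_mulVec]
    ext i
    rcases i with i | i <;> simp [hv, hv']
  · simp [hW, hW']

theorem isWalkPair_edgeless (n : ℕ) : IsWalkPair (q := q) n 1 n := by
  have hS : walkMatrix q (0 : Matrix (Fin n) (Fin n) ℤ) = 1 := by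
    ext i j : 2; simp [walkMatrix]
  exact ⟨0, ⟨by simp, by simp, by simp⟩, by rw [hS, Matrix.det_one], fun _ => 1, by simp [hS],
    by simp⟩

/-! ### Paths -/

/-- The walk data of a graph with a root: besides `C` and `W`, the root entry `r` of
`(1 + t A)⁻¹ e_root` and the root entry `h` of `(1 + t A)⁻¹ 1`. -/
def IsRootedWalkData [Fintype ι] (A : Matrix ι ι ℤ) (root : ι) (C W r h : (ZMod q)⟦X⟧) : Prop :=
  (walkMatrix q A).det = C ∧
    (∃ v, (walkMatrix q A).mulVec v = (fun _ => 1) ∧ ∑ i, v i = W ∧ v root = h) ∧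
    ∃ y, (walkMatrix q A).mulVec y = Pi.single root 1 ∧ y root = r

/-- The graph obtained by joining a new vertex, the new root, to the root. -/
def addPendant (A : Matrix ι ι ℤ) (root : ι) : Matrix (Unit ⊕ ι) (Unit ⊕ ι) ℤ :=
  Matrix.fromBlocks 0 (Matrix.replicateRow Unit (Pi.single root 1))
    (Matrix.replicateCol Unit (Pi.single root 1)) A

theorem isAdjacency_addPendant {A : Matrix ι ι ℤ} (hA : IsAdjacency A) (root : ι) :
    IsAdjacency (addPendant A root) := by
  have hsingle : ∀ i, (Pi.single root 1 : ι → ℤ) i = 0 ∨ (Pi.single root 1 : ι → ℤ) i = 1 :=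
    fun i => by by_cases h : i = root <;> simp [h]
  refine ⟨Matrix.IsSymm.fromBlocks (by simp) (by simp) hA.symm, ?_, ?_⟩
  · rintro (i | i)
    · rfl
    · exact hA.diag i
  · rintro (i | i) (j | j)
    · exact Or.inl rfl
    · exact hsingle j
    · exact hsingle i
    · exact hA.entry i j

/-- Adding a pendant vertex is a rank one update of `1 + t A`. -/
theorem IsRootedWalkData.addPendant [Fintype ι] {A : Matrix ι ι ℤ} (hA : A.IsSymm) {root : ι}
    {C W r h r' : (ZMod q)⟦X⟧} (hd : IsRootedWalkData A root C W r h)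
    (hr : r' * (1 - X ^ 2 * r) = 1) :
    IsRootedWalkData (_root_.addPendant A root) (Sum.inl ()) (C * (1 - X ^ 2 * r))
      (W + (1 - X * h) * (r' * (1 - X * h))) r' (r' * (1 - X * h)) := by
  obtain ⟨hC, ⟨v, hv, hW, hh⟩, y, hy, hyr⟩ := hd
  set S := walkMatrix q A
  set E : ι → (ZMod q)⟦X⟧ := Pi.single root 1
  have hS : walkMatrix q (_root_.addPendant A root)
      = Matrix.fromBlocks 1 (Matrix.replicateRow Unit ((X : (ZMod q)⟦X⟧) • E))
          (Matrix.replicateCol Unit ((X : (ZMod q)⟦X⟧) • E)) S := by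
    rw [_root_.addPendant, walkMatrix_fromBlocks]
    congr 1 <;> ext i j : 2
    · simp [walkMatrix]
    · by_cases hj : j = root <;> simp [E, hj]
    · by_cases hi : i = root <;> simp [E, hi]
  have hEdot : ∀ w : ι → (ZMod q)⟦X⟧, ∑ i, E i * w i = w root := fun w => by
    simp [E, Pi.single_apply]
  -- by symmetry `∑ y = 1ᵀ S⁻¹ e_root` is the root entry of `S⁻¹ 1`
  have hsum : ∑ i, y i = h := by
    have h1 : (fun _ => 1) ⬝ᵥ y = v ⬝ᵥ S.mulVec y := by
      rw [Matrix.dotProduct_mulVec, ← Matrix.mulVec_transpose, (walkMatrix_isSymm hA).eq, hv]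
    have h2 : v ⬝ᵥ E = v root := by rw [dotProduct_comm, dotProduct, hEdot]
    rw [hy, h2, hh] at h1
    simpa [dotProduct] using h1
  have hmul : ∀ (a : (ZMod q)⟦X⟧) (w : ι → (ZMod q)⟦X⟧) ,
      (walkMatrix q (_root_.addPendant A root)).mulVec (Sum.elim (fun _ => a) w)
        = Sum.elim (fun _ => a + X * w root) (a • (X : (ZMod q)⟦X⟧) • E + S.mulVec w) := by
    intro a w
    rw [hS, Matrix.fromBlocks_mulVec]
    congr 1
    · ext1 i
      simp only [Sum.elim_comp_inl, Sum.elim_comp_inr, Matrix.one_mulVec, Pi.add_apply]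
      congr 1
      simp only [Matrix.mulVec, dotProduct, Matrix.replicateRow_apply, Pi.smul_apply, smul_eq_mul,
        mul_assoc]
      rw [← Finset.mul_sum, hEdot]
    · ext1 i
      simp [Matrix.mulVec, dotProduct]
      ring
  refine ⟨?_, ⟨Sum.elim (fun _ => r' * (1 - X * h)) (v - (X * (r' * (1 - X * h))) • y), ?_, ?_, rfl⟩,
    Sum.elim (fun _ => r') (-(X * r') • y), ?_, rfl⟩
  · have hfac : S - Matrix.replicateCol Unit ((X : (ZMod q)⟦X⟧) • E) *
          Matrix.replicateRow Unit ((X : (ZMod q)⟦X⟧) • E)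
        = S * (1 - Matrix.replicateCol Unit ((X : (ZMod q)⟦X⟧) • y) *
          Matrix.replicateRow Unit ((X : (ZMod q)⟦X⟧) • E)) := by
      rw [Matrix.mul_sub, Matrix.mul_one, ← Matrix.mul_assoc, ← Matrix.replicateCol_mulVec,
        Matrix.mulVec_smul, hy]
    rw [hS, Matrix.det_fromBlocks_one₁₁, hfac, Matrix.det_mul, hC, Matrix.det_one_sub_mul_comm,
      Matrix.det_unique]
    simp only [Matrix.sub_apply, Matrix.one_apply_eq, Matrix.mul_apply, Matrix.replicateRow_apply,
      Matrix.replicateCol_apply, Pi.smul_apply, smul_eq_mul]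
    congr 2
    rw [Finset.sum_congr rfl fun i _ => show X * E i * (X * y i) = X ^ 2 * (E i * y i) by ring,
      ← Finset.mul_sum, hEdot, hyr]
  · rw [hmul, Matrix.mulVec_sub, Matrix.mulVec_smul, hv, hy]
    ext1 i
    rcases i with i | i
    · simp only [Sum.elim_inl, Pi.sub_apply, Pi.smul_apply, smul_eq_mul, hh, hyr]
      linear_combination (1 - X * h) * hr
    · simp only [Sum.elim_inr, Pi.add_apply, Pi.sub_apply, Pi.smul_apply, smul_eq_mul]
      ring
  · simp only [Fintype.sum_sum_type, Sum.elim_inl, Sum.elim_inr, Pi.sub_apply, Pi.smul_apply,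
      smul_eq_mul, Finset.sum_sub_distrib, ← Finset.mul_sum, hsum, hW]
    simp
    ring
  · rw [hmul, Matrix.mulVec_smul, hy]
    ext1 i
    rcases i with i | i
    · simp [hyr]
      linear_combination hr
    · simp
      ring

/-- The series `r` (see `IsRootedWalkData`) of the path with `k` vertices, rooted at an end. -/
noncomputable def pathReturn (q : ℕ) : ℕ → (ZMod q)⟦X⟧
  | 0 => 0
  | k + 1 => invOfUnit (1 - X ^ 2 * pathReturn q k) 1

/-- The series `h` (see `IsRootedWalkData`) of the path with `k` vertices, rooted at an end. -/
noncomputable def pathEnd (q : ℕ) : ℕ → (ZMod q)⟦X⟧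
  | 0 => 0
  | k + 1 => pathReturn q (k + 1) * (1 - X * pathEnd q k)

/-- The walk series of the path with `k` vertices. -/
noncomputable def pathWalk (q : ℕ) : ℕ → (ZMod q)⟦X⟧
  | 0 => 0
  | k + 1 => pathWalk q k + (1 - X * pathEnd q k) * pathEnd q (k + 1)

/-- The determinant `det (1 + t A)` of the path with `k` vertices. -/
noncomputable def pathDet (q : ℕ) : ℕ → (ZMod q)⟦X⟧
  | 0 => 1
  | k + 1 => pathDet q k * (1 - X ^ 2 * pathReturn q k)

theorem pathReturn_succ_mul (k : ℕ) :
    pathReturn q (k + 1) * (1 - X ^ 2 * pathReturn q k) = 1 := by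
  rw [pathReturn, mul_comm]
  exact mul_invOfUnit _ _ (by simp)

theorem isWalkPair_path (k : ℕ) : IsWalkPair k (pathDet q k) (pathWalk q k) := by
  have h1 : pathReturn q 1 = 1 := by simpa [pathReturn] using pathReturn_succ_mul (q := q) 0
  have key : ∀ k, ∃ (ι : Type) (_ : Fintype ι) (_ : DecidableEq ι) (A : Matrix ι ι ℤ) (root : ι),
      Fintype.card ι = k + 1 ∧ IsAdjacency A ∧ IsRootedWalkData A root (pathDet q (k + 1))
        (pathWalk q (k + 1)) (pathReturn q (k + 1)) (pathEnd q (k + 1)) := by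
    intro k
    induction k with
    | zero =>
      have hS : walkMatrix q (0 : Matrix Unit Unit ℤ) = 1 := by
        ext i j : 2; simp [walkMatrix]
      refine ⟨Unit, inferInstance, inferInstance, 0, (), rfl, ⟨by simp, by simp, by simp⟩, ?_,
        ⟨fun _ => 1, ?_, ?_, ?_⟩, Pi.single () 1, ?_, ?_⟩
      · simp [hS, pathDet, pathReturn]
      · simp [hS]
      · simp [pathWalk, pathEnd, h1]
      · simp [pathEnd, h1]
      · rw [hS, Matrix.one_mulVec]
      · simp [h1]
    | succ k ih =>
      obtain ⟨ι, _, _, A, root, hcard, hA, hd⟩ := ih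
      exact ⟨Unit ⊕ ι, inferInstance, inferInstance, addPendant A root, Sum.inl (),
        by simp [hcard, add_comm], isAdjacency_addPendant hA root,
        hd.addPendant hA.symm (pathReturn_succ_mul (k + 1))⟩
  rcases k with _ | k
  · simpa [pathDet, pathWalk] using isWalkPair_edgeless (q := q) 0
  · obtain ⟨ι, _, _, A, root, hcard, hA, hC, ⟨v, hv, hW, -⟩, -⟩ := key k
    exact IsWalkPairOf.isWalkPair hA ⟨hC, v, hv, hW⟩ hcard

end WalkSeries

/-! ### Second differences of paths -/

section PathDifferences

open PowerSeries

variable {q : ℕ}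

theorem X_dvd_pathReturn_sub_one (k : ℕ) : X ∣ pathReturn q (k + 1) - 1 :=
  ⟨X * pathReturn q k * pathReturn q (k + 1), by
    linear_combination pathReturn_succ_mul (q := q) k⟩

theorem X_pow_dvd_pathReturn_sub (k : ℕ) :
    X ^ (2 * k) ∣ pathReturn q (k + 1) - pathReturn q k := by
  induction k with
  | zero => simp
  | succ k ih =>
    obtain ⟨z, hz⟩ := ih
    refine ⟨pathReturn q (k + 2) * pathReturn q (k + 1) * z, ?_⟩
    linear_combination pathReturn q (k + 1) * pathReturn_succ_mul (q := q) (k + 1)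
      - pathReturn q (k + 2) * pathReturn_succ_mul (q := q) k
      + X ^ 2 * pathReturn q (k + 2) * pathReturn q (k + 1) * hz

theorem X_dvd_pathEnd_sub_one (k : ℕ) : X ∣ pathEnd q (k + 1) - 1 := by
  obtain ⟨z, hz⟩ := X_dvd_pathReturn_sub_one (q := q) k
  refine ⟨z - pathReturn q (k + 1) * pathEnd q k, ?_⟩
  rw [pathEnd]
  linear_combination hz

theorem X_pow_dvd_pathEnd_sub (k : ℕ) :
    X ^ (k + 1) ∣ pathEnd q (k + 1) - pathEnd q k - (-X) ^ k := by
  induction k with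
  | zero => simpa [pathEnd] using X_dvd_pathReturn_sub_one (q := q) 0
  | succ k ih =>
    obtain ⟨z, hz⟩ := ih
    obtain ⟨y, hy⟩ := X_pow_dvd_pathReturn_sub (q := q) (k + 1)
    obtain ⟨w, hw⟩ := X_dvd_pathReturn_sub_one (q := q) k
    refine ⟨X ^ k * y * (1 - X * pathEnd q (k + 1))
      - pathReturn q (k + 1) * z + (-1) ^ (k + 1) * w, ?_⟩
    have h1 : pathEnd q (k + 2) = pathReturn q (k + 2) * (1 - X * pathEnd q (k + 1)) := rfl
    have h2 : pathEnd q (k + 1) = pathReturn q (k + 1) * (1 - X * pathEnd q k) := rfl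
    have hsign : (-X : (ZMod q)⟦X⟧) ^ k = (-1) ^ k * X ^ k := neg_pow _ _
    rw [show (-X : (ZMod q)⟦X⟧) ^ (k + 1) = -(-1) ^ k * X ^ (k + 1) by
      rw [neg_pow, pow_succ (-1 : (ZMod q)⟦X⟧)]; ring, show k + 1 + 1 = k + 2 from rfl, h1]
    rw [hsign] at hz
    rw [pow_succ (-1 : (ZMod q)⟦X⟧)]
    linear_combination (1 - X * pathEnd q (k + 1)) * hy - h2
      - X * pathReturn q (k + 1) * hz - (-1) ^ k * X ^ (k + 1) * hw

/-- Only the two walks along the whole path survive in degree `m` when the walks on `m + 1`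
vertices that avoid an end vertex are removed by inclusion and exclusion. -/
theorem X_pow_dvd_pathWalk_second_diff (m : ℕ) (hm : 1 ≤ m) :
    X ^ (m + 1) ∣ pathWalk q (m + 1) - 2 * pathWalk q m + pathWalk q (m - 1) - 2 * (-X) ^ m := by
  obtain ⟨m, rfl⟩ : ∃ m', m = m' + 1 := ⟨m - 1, by omega⟩
  obtain ⟨z, hz⟩ := X_pow_dvd_pathEnd_sub (q := q) (m + 1)
  obtain ⟨y, hy⟩ := X_pow_dvd_pathEnd_sub (q := q) m
  obtain ⟨w, hw⟩ := X_dvd_pathEnd_sub_one (q := q) m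
  rw [Nat.add_sub_cancel]
  have h1 : pathWalk q (m + 1 + 1)
    = pathWalk q (m + 1) + (1 - X * pathEnd q (m + 1)) * pathEnd q (m + 1 + 1) := rfl
  have h2 : pathWalk q (m + 1) = pathWalk q m + (1 - X * pathEnd q m) * pathEnd q (m + 1) := rfl
  have hsign : ∀ k, (-X : (ZMod q)⟦X⟧) ^ k = (-1) ^ k * X ^ k := fun k => neg_pow _ _
  rw [hsign] at hz hy
  rw [hsign, h1]
  refine ⟨(1 - X * pathEnd q (m + 1)) * z - pathEnd q (m + 1) * y
    + (-1) ^ m * pathEnd q (m + 1) - (-1) ^ m * w, ?_⟩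
  rw [pow_succ (-1 : (ZMod q)⟦X⟧)] at hz ⊢
  linear_combination (1 - X * pathEnd q (m + 1)) * hz - X * pathEnd q (m + 1) * hy - h2
    - (-1) ^ m * X ^ (m + 1) * hw

theorem pathDet_eq_mul_pathReturn (m : ℕ) :
    pathDet q m = pathDet q (m + 1) * pathReturn q (m + 1) := by
  rw [pathDet]
  linear_combination - pathDet q m * pathReturn_succ_mul (q := q) m

theorem exists_pathDet_cassini (m : ℕ) :
    ∃ x, pathDet q (m + 2) * pathDet q m = pathDet q (m + 1) ^ 2 * (1 + X ^ (2 * (m + 1)) * x) := by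
  obtain ⟨y, hy⟩ := X_pow_dvd_pathReturn_sub (q := q) m
  refine ⟨-y * pathReturn q (m + 1), ?_⟩
  have h1 : pathDet q (m + 2) = pathDet q (m + 1) * (1 - X ^ 2 * pathReturn q (m + 1)) := rfl
  have h2 := pathDet_eq_mul_pathReturn (q := q) m
  have h3 := pathReturn_succ_mul (q := q) m
  rw [h1]
  linear_combination pathDet q (m + 1) * (1 - X ^ 2 * pathReturn q (m + 1)) * h2
    + pathDet q (m + 1) ^ 2 * h3
    - pathDet q (m + 1) ^ 2 * pathReturn q (m + 1) * X ^ 2 * hy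

theorem X_dvd_pathDet_sub_one (m : ℕ) : X ∣ pathDet q m - 1 := by
  induction m with
  | zero => simp [pathDet]
  | succ m ih =>
    obtain ⟨z, hz⟩ := ih
    refine ⟨z - pathDet q m * X * pathReturn q m, ?_⟩
    rw [pathDet]
    linear_combination hz

end PathDifferences

/-! ### Pairs attained by all large graphs -/

section Attained

open PowerSeries

variable {q e : ℕ}

/-- Up to degree `e`, every large `n` is the order of a graph with determinant `C` and walk series
`n + W`. -/
def EventuallyAttained (e : ℕ) (C W : (ZMod q)⟦X⟧) : Prop :=
  ∃ N, ∀ n ≥ N, ∃ C' W', IsWalkPair n C' W' ∧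
    X ^ (e + 1) ∣ C' - C ∧ X ^ (e + 1) ∣ W' - ((n : (ZMod q)⟦X⟧) + W)

theorem EventuallyAttained.congr {C W C' W' : (ZMod q)⟦X⟧} (h : EventuallyAttained e C W)
    (hC : X ^ (e + 1) ∣ C - C') (hW : X ^ (e + 1) ∣ W - W') : EventuallyAttained e C' W' := by
  obtain ⟨N, hN⟩ := h
  refine ⟨N, fun n hn => ?_⟩
  obtain ⟨D, V, hp, hD, hV⟩ := hN n hn
  refine ⟨D, V, hp, ?_, ?_⟩
  · simpa using dvd_add hD hC
  · convert dvd_add hV hW using 1; ring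

theorem eventuallyAttained_one : EventuallyAttained (q := q) e 1 0 :=
  ⟨0, fun n _ => ⟨1, n, isWalkPair_edgeless n, by simp, by simp⟩⟩

theorem EventuallyAttained.mul {C W C' W' : (ZMod q)⟦X⟧} (h : EventuallyAttained e C W)
    (h' : EventuallyAttained e C' W') : EventuallyAttained e (C * C') (W + W') := by
  obtain ⟨N, hN⟩ := h
  obtain ⟨N', hN'⟩ := h'
  refine ⟨N + N', fun n hn => ?_⟩
  obtain ⟨D, V, hp, ⟨a, ha⟩, ⟨b, hb⟩⟩ := hN N le_rfl
  obtain ⟨D', V', hp', ⟨a', ha'⟩, ⟨b', hb'⟩⟩ := hN' (n - N) (by omega)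
  have hpp := hp.union hp'
  rw [Nat.add_sub_cancel' (by omega)] at hpp
  refine ⟨_, _, hpp, ⟨a * D' + C * a', ?_⟩, ⟨b + b', ?_⟩⟩
  · linear_combination D' * ha + C * ha'
  · have hcast : ((n - N : ℕ) : (ZMod q)⟦X⟧) = n - N := by
      rw [Nat.cast_sub (by omega)]
    rw [hcast] at hb'
    linear_combination hb + hb'

theorem EventuallyAttained.pow {C W : (ZMod q)⟦X⟧} (h : EventuallyAttained e C W) (c : ℕ) :
    EventuallyAttained e (C ^ c) (c * W) := by
  induction c with
  | zero => simpa using eventuallyAttained_one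
  | succ c ih =>
    have := ih.mul h
    rw [pow_succ]
    convert this using 1
    push_cast
    ring

theorem natCast_powerSeries_self : (q : (ZMod q)⟦X⟧) = 0 := by
  rw [← map_natCast (C (R := ZMod q)), ZMod.natCast_self, map_zero]

/-- Raising `1 + O(t ^ j)` to the power `q` gives `1 + O(t ^ (j + 1))` modulo `q`. -/
theorem X_pow_dvd_pow_sub_one {C : (ZMod q)⟦X⟧} (hC : X ∣ C - 1) (j : ℕ) :
    X ^ (j + 1) ∣ C ^ q ^ j - 1 := by
  induction j with
  | zero => simpa using hC
  | succ j ih =>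
    set D := C ^ q ^ j
    have hsum : X ∣ ∑ i ∈ Finset.range q, D ^ i := by
      have h1 : ∑ i ∈ Finset.range q, D ^ i = ∑ i ∈ Finset.range q, (D ^ i - 1) := by
        rw [Finset.sum_sub_distrib]
        simp [natCast_powerSeries_self]
      rw [h1]
      refine Finset.dvd_sum fun i _ => ?_
      have h2 : X ∣ D - 1 := (Dvd.intro_left _ (pow_succ X j).symm).trans ih
      exact h2.trans (by simpa using sub_dvd_pow_sub_pow D 1 i)
    have h3 := mul_dvd_mul ih hsum
    rw [mul_comm (D - 1), geom_sum_mul, ← pow_succ] at h3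
    rwa [pow_succ q, pow_mul]

/-- Inverses come for free, since the pairs up to degree `e` have finite order. -/
theorem EventuallyAttained.inv {C W : (ZMod q)⟦X⟧} (hq : 0 < q) (he : 0 < e)
    (h : EventuallyAttained e C W) (hC : X ∣ C - 1) :
    ∃ D, EventuallyAttained e D (-W) ∧ X ^ (e + 1) ∣ C * D - 1 := by
  have hpos : 0 < q ^ e := pow_pos hq e
  refine ⟨C ^ (q ^ e - 1), ?_, ?_⟩
  · have := h.pow (q ^ e - 1)
    rw [Nat.cast_sub hpos, Nat.cast_pow, natCast_powerSeries_self, zero_pow he.ne'] at this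
    simpa using this
  · rw [← pow_succ', Nat.sub_add_cancel hpos]
    exact X_pow_dvd_pow_sub_one hC e

theorem eventuallyAttained_path (k : ℕ) :
    EventuallyAttained (q := q) e (pathDet q k) (pathWalk q k - k) := by
  refine ⟨k, fun n hn => ⟨pathDet q k,
    pathWalk q k + ((n : (ZMod q)⟦X⟧) - (k : (ZMod q)⟦X⟧)), ?_,
    by rw [sub_self]; exact dvd_zero _, ⟨0, by ring⟩⟩⟩
  have h := (isWalkPair_path (q := q) k).union (isWalkPair_edgeless (n - k))
  rwa [Nat.add_sub_cancel' hn, mul_one, Nat.cast_sub hn] at h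

/-- The second difference of paths: a virtual graph whose walk series starts in degree `m`, and
whose determinant is even closer to `1`. -/
theorem exists_eventuallyAttained_second_diff (hq : 0 < q) (he : 0 < e) (m : ℕ) (hm : 2 ≤ m) :
    ∃ x y : (ZMod q)⟦X⟧, EventuallyAttained e (1 + X ^ (m + 2) * x)
      (2 * (-X) ^ m + X ^ (m + 1) * y) := by
  obtain ⟨y, hy⟩ := X_pow_dvd_pathWalk_second_diff (q := q) m (by omega)
  obtain ⟨m, rfl⟩ : ∃ m', m = m' + 1 := ⟨m - 1, by omega⟩
  rw [Nat.add_sub_cancel] at hy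
  obtain ⟨x, hx⟩ := exists_pathDet_cassini (q := q) m
  obtain ⟨D, hD, ⟨d, hd⟩⟩ := (eventuallyAttained_path (q := q) (e := e) (m + 1)).inv hq he
    (X_dvd_pathDet_sub_one _)
  refine ⟨X ^ (m - 1) * x, y, ?_⟩
  have hpow : X ^ (m + 1 + 2) * (X ^ (m - 1) * x) = X ^ (2 * (m + 1)) * x := by
    rw [← mul_assoc, ← pow_add]
    congr 2
    omega
  rw [hpow]
  set P := pathDet q (m + 1)
  refine (((eventuallyAttained_path (m + 2)).mul (eventuallyAttained_path m)).mul
    (hD.mul hD)).congr ⟨(1 + X ^ (2 * (m + 1)) * x) * d * (P * D + 1), ?_⟩ ⟨0, ?_⟩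
  · rw [hx]
    linear_combination (1 + X ^ (2 * (m + 1)) * x) * (P * D + 1) * hd
  · push_cast
    linear_combination hy

end Attained

/-! ### Prescribing the coefficients -/

section Prescribe

open PowerSeries

variable {q e : ℕ}

/-- A multiple of the second difference of paths changes the coefficient of index `m + 1` of
`C (2 - t (n + W))` by any given even number, and no coefficient of smaller index. -/
theorem EventuallyAttained.adjust (hq : 0 < q) (he : 0 < e) {C W : (ZMod q)⟦X⟧} (ν : (ZMod q)⟦X⟧)
    (h : EventuallyAttained e C W) (hC : X ∣ C - 1) {m : ℕ} (hm : 2 ≤ m) (z : ℤ) :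
    ∃ C' W', EventuallyAttained e C' W' ∧ X ∣ C' - 1 ∧ X ^ (m + 2) ∣
      C' * (2 - X * (ν + W')) - (C * (2 - X * (ν + W)) + 2 * (z : (ZMod q)⟦X⟧) * X ^ (m + 1)) := by
  obtain ⟨x, y, hg⟩ := exists_eventuallyAttained_second_diff (q := q) (e := e) hq he m hm
  obtain ⟨c, hc⟩ : ∃ c : ℕ, (c : (ZMod q)⟦X⟧) = (-1) ^ (m + 1) * (z : (ZMod q)⟦X⟧) := by
    have : NeZero q := ⟨hq.ne'⟩
    refine ⟨(((-1) ^ (m + 1) * z : ℤ) : ZMod q).val, ?_⟩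
    have h1 : ∀ w : ℤ, ((w : ZMod q).val : (ZMod q)⟦X⟧) = (w : (ZMod q)⟦X⟧) := fun w => by
      rw [← map_natCast (PowerSeries.C (R := ZMod q)), ZMod.natCast_zmod_val,
        map_intCast]
    rw [h1]
    push_cast
    rfl
  obtain ⟨x', hx'⟩ : X ^ (m + 2) ∣ (1 + X ^ (m + 2) * x) ^ c - 1 := by
    refine dvd_trans ?_ (sub_one_dvd_pow_sub_one _ c)
    simp
  obtain ⟨w, hw⟩ := hC
  have hpow := sub_eq_iff_eq_add'.mp hx'
  have hsign : (c : (ZMod q)⟦X⟧) * (-X) ^ m = -(z : (ZMod q)⟦X⟧) * X ^ m := by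
    have h1 : ((-1 : (ZMod q)⟦X⟧) ^ m) ^ 2 = 1 := by rw [← pow_mul, pow_mul', neg_one_sq, one_pow]
    rw [hc, neg_pow, pow_succ]
    linear_combination -(z : (ZMod q)⟦X⟧) * X ^ m * h1
  refine ⟨_, _, h.mul (hg.pow c), ⟨w + C * X ^ (m + 1) * x', ?_⟩,
    ⟨C * x' * (2 - X * (ν + W) + 2 * (z : (ZMod q)⟦X⟧) * X ^ (m + 1)
        - (c : (ZMod q)⟦X⟧) * X ^ (m + 2) * y)
      + 2 * (z : (ZMod q)⟦X⟧) * w - C * (c : (ZMod q)⟦X⟧) * y, ?_⟩⟩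
  · rw [hpow]
    linear_combination hw
  · rw [hpow]
    linear_combination (-2 * X * C * (1 + X ^ (m + 2) * x')) * hsign
      + 2 * (z : (ZMod q)⟦X⟧) * X ^ (m + 1) * hw

theorem coeff_two_mul_intCast_mul_X_pow (z : ℤ) (m j : ℕ) :
    coeff j (2 * (z : (ZMod q)⟦X⟧) * X ^ m) = if j = m then 2 * (z : ZMod q) else 0 := by
  have : (2 * (z : (ZMod q)⟦X⟧)) = PowerSeries.C (2 * (z : ZMod q)) := by
    rw [map_mul, map_intCast, map_ofNat]
  rw [this, coeff_C_mul, coeff_X_pow]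
  split_ifs <;> simp

/-- The halves of the coefficients can be prescribed one after the other. -/
theorem exists_eventuallyAttained_coeff (hq : 0 < q) (he : 0 < e) (ν : (ZMod q)⟦X⟧) (ε : ZMod q)
    (hstart : ∃ C W, EventuallyAttained e C W ∧ X ∣ C - 1 ∧
      ∃ γ : ℤ, coeff 3 (C * (2 - X * (ν + W))) = ε + 2 * (γ : ZMod q)) (β : ℕ → ℤ) (k : ℕ) :
    ∃ C W, EventuallyAttained e C W ∧ X ∣ C - 1 ∧
      (∃ γ : ℤ, coeff 3 (C * (2 - X * (ν + W))) = ε + 2 * (γ : ZMod q)) ∧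
      ∀ j, 3 ≤ j → j < k → ∃ δ : ℤ, (δ = 0 ∨ δ = 1) ∧
        coeff j (C * (2 - X * (ν + W))) = (δ : ZMod q) + 2 * (β j : ZMod q) := by
  induction k with
  | zero =>
    obtain ⟨C, W, h1, h2, h3⟩ := hstart
    exact ⟨C, W, h1, h2, h3, fun j _ hj => by omega⟩
  | succ k ih =>
    obtain ⟨C, W, h1, h2, ⟨γ, h3⟩, h4⟩ := ih
    rcases Nat.lt_or_ge k 3 with hk | hk
    · exact ⟨C, W, h1, h2, ⟨γ, h3⟩, fun j _ _ => by omega⟩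
    obtain ⟨m, rfl⟩ : ∃ m, k = m + 1 := ⟨k - 1, by omega⟩
    obtain ⟨a, ha⟩ := ZMod.intCast_surjective (coeff (m + 1) (C * (2 - X * (ν + W))))
    obtain ⟨C', W', h1', h2', h5⟩ := h1.adjust hq he ν h2 (m := m) (by omega) (β (m + 1) - a / 2)
    rw [X_pow_dvd_iff] at h5
    have hcoeff : ∀ j < m + 2, coeff j (C' * (2 - X * (ν + W')))
        = coeff j (C * (2 - X * (ν + W)))
          + if j = m + 1 then 2 * ((β (m + 1) - a / 2 : ℤ) : ZMod q) else 0 := fun j hj => by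
      have := h5 j hj
      rwa [map_sub, map_add, coeff_two_mul_intCast_mul_X_pow, sub_eq_zero] at this
    refine ⟨C', W', h1', h2', ?_, fun j hj3 hj => ?_⟩
    · rw [hcoeff 3 (by omega), h3]
      split_ifs with h
      · exact ⟨γ + (β (m + 1) - a / 2), by push_cast; ring⟩
      · exact ⟨γ, by ring⟩
    · rw [hcoeff j (by omega)]
      split_ifs with h
      · refine ⟨a % 2, by omega, ?_⟩
        rw [h, ← ha]
        conv_lhs => rw [← Int.emod_add_mul_ediv a 2]
        push_cast
        rw [show (a % 2 + 2 * (a / 2)) / 2 = a / 2 by omega]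
        ring
      · obtain ⟨δ, hδ, hj'⟩ := h4 j hj3 (by omega)
        exact ⟨δ, hδ, by rw [add_zero, hj']⟩

theorem exists_start_even (ν : ZMod q) : ∃ C W, EventuallyAttained e C W ∧ X ∣ C - 1 ∧
    ∃ γ : ℤ, coeff 3 (C * (2 - X * (PowerSeries.C ν + W))) = 0 + 2 * (γ : ZMod q) := by
  refine ⟨1, 0, eventuallyAttained_one, by simp, 0, ?_⟩
  rw [one_mul, add_zero, map_sub, show (3 : ℕ) = 2 + 1 from rfl, coeff_succ_X_mul,
    show (2 : (ZMod q)⟦X⟧) = PowerSeries.C 2 from rfl, coeff_C, coeff_C]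
  simp

/-- A single edge changes the parity of the coefficient of index `3` when `n` is odd. -/
theorem exists_start_odd {n : ℕ} (hn : Odd n) : ∃ C W, EventuallyAttained e C W ∧ X ∣ C - 1 ∧
    ∃ γ : ℤ, coeff 3 (C * (2 - X * (PowerSeries.C (n : ZMod q) + W))) = 1 + 2 * (γ : ZMod q) := by
  refine ⟨_, _, eventuallyAttained_path 2, X_dvd_pathDet_sub_one 2, ?_⟩
  obtain ⟨k, rfl⟩ := hn
  have h1 : pathReturn q 1 = 1 := by simpa [pathReturn] using pathReturn_succ_mul (q := q) 0
  have h2 : pathReturn q 2 * (1 - X ^ 2) = 1 := by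
    simpa [h1] using pathReturn_succ_mul (q := q) 1
  have hC : pathDet q 2 = 1 - X ^ 2 := by simp [pathDet, h1, show pathReturn q 0 = 0 from rfl]
  have hW : pathWalk q 2 = 1 + (1 - X) * (pathReturn q 2 * (1 - X)) := by
    simp [pathWalk, pathEnd, h1]
  have hB : pathDet q 2 * (2 - X * (PowerSeries.C ((2 * k + 1 : ℕ) : ZMod q)
      + (pathWalk q 2 - ((2 : ℕ) : (ZMod q)⟦X⟧))))
      = PowerSeries.C 2 - PowerSeries.C ((2 * k + 1 : ℕ) : ZMod q) * X ^ 1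
        + PowerSeries.C (2 * k - 1 : ZMod q) * X ^ 3 := by
    rw [hC, hW]
    simp only [map_natCast, map_sub, map_mul, map_ofNat, map_one]
    push_cast
    linear_combination (-X * (1 - X) ^ 2) * h2
  refine ⟨k - 1, ?_⟩
  rw [hB, map_add, map_sub, coeff_C_mul, coeff_C_mul, coeff_X_pow, coeff_X_pow, coeff_C]
  simp
  ring

end Prescribe

/-! ### Realization by graphs of every large order -/

section Realization

open PowerSeries

variable {q e n : ℕ}

theorem reduceSeries_signPoly {A : Matrix (Fin n) (Fin n) ℤ} {C W : (ZMod q)⟦X⟧}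
    (h : IsWalkPairOf A C W) : reduceSeries q (signPoly A) = C * (2 - X * W) := by
  obtain ⟨hC, v, hv, hW⟩ := h
  set φ := reduceSeries q
  have hX : φ Polynomial.X = X := by simp [φ, reduceSeries]
  have hpencil : φ.mapMatrix (pencil A) = walkMatrix q A := by
    refine Matrix.ext fun i j => ?_
    by_cases h : i = j <;> simp [pencil, walkMatrix, h, hX]
  have hdet : φ (pencil A).det = C := by rw [RingHom.map_det, hpencil, hC]
  have hones : φ.mapMatrix (onesMatrix (Fin n) (Polynomial ℤ)) = onesMatrix _ _ := by
    ext i j : 2; simp [onesMatrix]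
  have hfac : walkMatrix q A - onesMatrix _ _
      = walkMatrix q A * (1 - Matrix.replicateCol Unit v *
          Matrix.replicateRow Unit (1 : Fin n → (ZMod q)⟦X⟧)) := by
    rw [Matrix.mul_sub, Matrix.mul_one, ← Matrix.mul_assoc, ← Matrix.replicateCol_mulVec, hv]
    congr 1
    ext i j : 2
    simp [onesMatrix, Matrix.mul_apply]
  have hdefect : φ (onesDefect A) = C * W := by
    rw [onesDefect, map_sub, hdet, RingHom.map_det, map_sub, hpencil, hones, hfac, Matrix.det_mul,
      hC, Matrix.det_one_sub_mul_comm, Matrix.det_unique]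
    simp [Matrix.mul_apply, hW]
    ring
  rw [signPoly, map_sub, map_mul, map_mul, hdet, hdefect, hX, map_ofNat]
  ring

theorem EventuallyAttained.exists_isAdjacency {C W : (ZMod q)⟦X⟧} (h : EventuallyAttained e C W) :
    ∃ N, ∀ n ≥ N, ∃ A : Matrix (Fin n) (Fin n) ℤ, IsAdjacency A ∧ ∀ j ≤ e,
      ((signPoly A).coeff j : ZMod q)
        = coeff j (C * (2 - X * (PowerSeries.C (n : ZMod q) + W))) := by
  obtain ⟨N, hN⟩ := h
  refine ⟨N, fun n hn => ?_⟩
  obtain ⟨C', W', ⟨A, hA, hp⟩, ⟨a, ha⟩, ⟨b, hb⟩⟩ := hN n hn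
  refine ⟨A, hA, fun j hj => ?_⟩
  rw [← coeff_reduceSeries, reduceSeries_signPoly hp, ← sub_eq_zero, ← map_sub]
  refine (X_pow_dvd_iff (n := e + 1)).mp ⟨a * (2 - X * W') - C * X * b, ?_⟩ j (by omega)
  rw [map_natCast]
  linear_combination (2 - X * W') * ha - C * X * hb

/-- In every large order, the parity `ε` of the coefficient of index `3` (in odd order) and the
integer parts of the halves of the coefficients of index `3, …, e` can be prescribed modulo `q`. -/
theorem exists_signPoly_coeff (hq : 0 < q) (he : 3 ≤ e) :
    ∃ N, ∀ n ≥ N, ∀ ε : ZMod 2, (Odd n ∨ ε = 0) → ∀ β : ℕ → ℤ,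
      ∃ A : Matrix (Fin n) (Fin n) ℤ, IsAdjacency A ∧
        (∃ γ : ℤ, ((signPoly A).coeff 3 : ZMod q) = (ε.val : ZMod q) + 2 * (γ : ZMod q)) ∧
        ∀ j, 3 ≤ j → j ≤ e → ∃ δ : ℤ, (δ = 0 ∨ δ = 1) ∧
          ((signPoly A).coeff j : ZMod q) = (δ : ZMod q) + 2 * (β j : ZMod q) := by
  have : NeZero q := ⟨hq.ne'⟩
  -- for a fixed residue of `n` and fixed data modulo `q` the bound exists; the data are finite
  have key : ∀ x : ZMod q × ZMod 2 × (Fin (e + 1) → ZMod q), ∃ N : ℕ, ∀ n : ℕ, n ≥ N →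
      (n : ZMod q) = x.1 →
      (Odd n ∨ x.2.1 = 0) → ∃ A : Matrix (Fin n) (Fin n) ℤ, IsAdjacency A ∧
        (∃ γ : ℤ, ((signPoly A).coeff 3 : ZMod q) = (x.2.1.val : ZMod q) + 2 * (γ : ZMod q)) ∧
        ∀ j : Fin (e + 1), 3 ≤ (j : ℕ) → ∃ δ : ℤ, (δ = 0 ∨ δ = 1) ∧
          ((signPoly A).coeff j : ZMod q) = (δ : ZMod q) + 2 * x.2.2 j := by
    rintro ⟨ν, ε, β⟩
    by_cases hstart : ∃ C W, EventuallyAttained e C W ∧ X ∣ C - 1 ∧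
      ∃ γ : ℤ, coeff 3 (C * (2 - X * (PowerSeries.C ν + W)))
        = (ε.val : ZMod q) + 2 * (γ : ZMod q)
    · choose lift hlift using ZMod.intCast_surjective (n := q)
      obtain ⟨C, W, h1, -, ⟨γ, h3⟩, h4⟩ := exists_eventuallyAttained_coeff hq (by omega : 0 < e)
        (PowerSeries.C ν) _ hstart (fun j => if h : j < e + 1 then lift (β ⟨j, h⟩) else 0) (e + 1)
      obtain ⟨N, hN⟩ := h1.exists_isAdjacency
      refine ⟨N, fun n hn hν _ => ?_⟩
      obtain ⟨A, hA, hcoeff⟩ := hN n hn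
      simp only at hν
      rw [hν] at hcoeff
      refine ⟨A, hA, ⟨γ, by rw [hcoeff 3 he, h3]⟩, fun j hj => ?_⟩
      obtain ⟨δ, hδ, hj'⟩ := h4 j hj j.2
      refine ⟨δ, hδ, ?_⟩
      rw [hcoeff j (by omega), hj', dif_pos j.2, hlift]
    · refine ⟨0, fun n _ hν hε => absurd ?_ hstart⟩
      simp only at hν hε
      subst hν
      by_cases h0 : ε = 0
      · subst h0
        rw [ZMod.val_zero, Nat.cast_zero]
        exact exists_start_even (n : ZMod q)
      · have h1 : ∀ x : ZMod 2, x ≠ 0 → x.val = 1 := by decide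
        rw [h1 ε h0, Nat.cast_one]
        exact exists_start_odd (hε.resolve_right h0)
  choose N hN using key
  refine ⟨Finset.univ.sup N, fun n hn ε hε β => ?_⟩
  obtain ⟨A, hA, hγ, hj⟩ := hN (n, ε, fun j => (β j : ZMod q)) n
    ((Finset.le_sup (Finset.mem_univ _)).trans hn) rfl hε
  exact ⟨A, hA, hγ, fun j h3 hje => hj ⟨j, by omega⟩ h3⟩

end Realization

/-! ### Counting the classes -/

section Counting

variable {e n : ℕ}

/-- The matrix `A` with `M = J - 2A`. -/
def graphOf (M : Matrix (Fin n) (Fin n) ℤ) : Matrix (Fin n) (Fin n) ℤ :=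
  Matrix.of fun i j => (1 - M i j) / 2

/-- The integers `b_k` with `a_k = 2 ^ (k - 1) b_k`. -/
noncomputable def halvedCoeff (M : Matrix (Fin n) (Fin n) ℤ) (k : ℕ) : ℤ :=
  (signPoly (graphOf M)).coeff k

variable {M M' : Matrix (Fin n) (Fin n) ℤ}

theorem ones_sub_graphOf (hM : M ∈ symmSignMatrices n) :
    onesMatrix _ ℤ - (2 : ℤ) • graphOf M = M := by
  refine Matrix.ext fun i j => ?_
  change 1 - 2 * ((1 - M i j) / 2) = M i j
  rcases hM.1 i j with h | h <;> rw [h] <;> norm_num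

theorem isAdjacency_graphOf (hM : M ∈ symmSignMatrices n) : IsAdjacency (graphOf M) := by
  refine ⟨Matrix.IsSymm.ext fun i j => ?_, fun i => ?_, fun i j => ?_⟩
  · change (1 - M j i) / 2 = (1 - M i j) / 2
    rw [show M j i = M i j from congrFun₂ hM.2.1 i j]
  · change (1 - M i i) / 2 = 0
    rw [hM.2.2 i]; norm_num
  · change (1 - M i j) / 2 = 0 ∨ (1 - M i j) / 2 = 1
    rcases hM.1 i j with h | h <;> rw [h] <;> norm_num

theorem IsAdjacency.ones_sub_mem {A : Matrix (Fin n) (Fin n) ℤ} (hA : IsAdjacency A) :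
    onesMatrix _ ℤ - (2 : ℤ) • A ∈ symmSignMatrices n := by
  have hij : ∀ i j, (onesMatrix (Fin n) ℤ - (2 : ℤ) • A) i j = 1 - 2 * A i j := fun _ _ => rfl
  refine ⟨fun i j => ?_, Matrix.ext fun i j => ?_, fun i => ?_⟩
  · rw [hij]
    rcases hA.entry i j with h | h <;> rw [h] <;> norm_num
  · rw [Matrix.transpose_apply, hij, hij, hA.symm.apply]
  · rw [hij, hA.diag]; norm_num

theorem graphOf_ones_sub (A : Matrix (Fin n) (Fin n) ℤ) :
    graphOf (onesMatrix _ ℤ - (2 : ℤ) • A) = A := by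
  refine Matrix.ext fun i j => ?_
  change (1 - (1 - 2 * A i j)) / 2 = A i j
  omega

theorem charCoeff_succ (hM : M ∈ symmSignMatrices n) (k : ℕ) :
    charCoeff M (k + 1) = 2 ^ k * halvedCoeff M (k + 1) := by
  conv_lhs => rw [← ones_sub_graphOf hM]
  exact charCoeff_ones_sub_succ _ _

theorem halvedCoeff_one (hM : M ∈ symmSignMatrices n) : halvedCoeff M 1 = -n := by
  have := charCoeff_succ hM 0
  rw [zero_add, charCoeff_one hM] at this
  linarith

theorem halvedCoeff_two (hM : M ∈ symmSignMatrices n) : halvedCoeff M 2 = 0 := by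
  have := charCoeff_succ hM 1
  rw [charCoeff_two hM] at this
  linarith

theorem two_dvd_halvedCoeff (hn : Even n) (hM : M ∈ symmSignMatrices n) (k : ℕ) :
    2 ∣ halvedCoeff M k :=
  two_dvd_coeff_signPoly hn (isAdjacency_graphOf hM).symm (isAdjacency_graphOf hM).diag k

theorem halvedCoeff_modEq_two (hM : M ∈ symmSignMatrices n)
    (hM' : M' ∈ symmSignMatrices n) {k : ℕ} (hk : 4 ≤ k)
    (h : ∀ j, 3 ≤ j → j < k → halvedCoeff M j ≡ halvedCoeff M' j [ZMOD 4]) :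
    halvedCoeff M k ≡ halvedCoeff M' k [ZMOD 2] := by
  rcases Nat.even_or_odd n with hn | hn
  · exact (Int.emod_eq_zero_of_dvd (two_dvd_halvedCoeff hn hM k)).trans
      (Int.emod_eq_zero_of_dvd (two_dvd_halvedCoeff hn hM' k)).symm
  · have hA := isAdjacency_graphOf hM
    have hA' := isAdjacency_graphOf hM'
    refine coeff_signPoly_modEq_two hn hA.symm hA.diag (by rwa [ones_sub_graphOf hM]) hA'.symm
      hA'.diag (by rwa [ones_sub_graphOf hM']) hk fun j hj1 hjk => ?_
    change halvedCoeff M j ≡ halvedCoeff M' j [ZMOD 4]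
    obtain rfl | rfl | hj3 : j = 1 ∨ j = 2 ∨ 3 ≤ j := by omega
    · rw [halvedCoeff_one hM, halvedCoeff_one hM']
    · rw [halvedCoeff_two hM, halvedCoeff_two hM']
    · exact h j hj3 hjk

theorem charCoeff_modEq_iff (hM : M ∈ symmSignMatrices n) (hM' : M' ∈ symmSignMatrices n) {k : ℕ}
    (hk : 1 ≤ k) (hke : k ≤ e) : charCoeff M k ≡ charCoeff M' k [ZMOD 2 ^ e] ↔
      halvedCoeff M k ≡ halvedCoeff M' k [ZMOD 2 ^ (e + 1 - k)] := by
  obtain ⟨k, rfl⟩ : ∃ k', k = k' + 1 := ⟨k - 1, by omega⟩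
  rw [charCoeff_succ hM, charCoeff_succ hM', show e = k + (e + 1 - (k + 1)) by omega, pow_add,
    show k + (e + 1 - (k + 1)) + 1 - (k + 1) = e + 1 - (k + 1) by omega]
  rw [Int.modEq_iff_dvd, Int.modEq_iff_dvd, ← mul_sub]
  exact mul_dvd_mul_iff_left (by positivity)

/-- All coefficients of the characteristic polynomials agree modulo `2 ^ e`. -/
def CharCongr (e : ℕ) (M M' : Matrix (Fin n) (Fin n) ℤ) : Prop :=
  ∀ k, charCoeff M k ≡ charCoeff M' k [ZMOD 2 ^ e]

/-- Only the coefficients `a_3, …, a_e` matter, as `2 ^ e ∣ a_k` for `k > e`. -/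
theorem charCongr_iff (hM : M ∈ symmSignMatrices n) (hM' : M' ∈ symmSignMatrices n) :
    CharCongr e M M' ↔ ∀ k, 3 ≤ k → k ≤ e → charCoeff M k ≡ charCoeff M' k [ZMOD 2 ^ e] := by
  refine ⟨fun h k _ _ => h k, fun h k => ?_⟩
  obtain rfl | rfl | rfl | hk : k = 0 ∨ k = 1 ∨ k = 2 ∨ 3 ≤ k := by omega
  · rw [charCoeff_zero, charCoeff_zero]
  · rw [charCoeff_one hM, charCoeff_one hM']
  · rw [charCoeff_two hM, charCoeff_two hM']
  rcases Nat.lt_or_ge e k with hke | hke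
  · obtain ⟨k, rfl⟩ : ∃ k', k = k' + 1 := ⟨k - 1, by omega⟩
    have hdvd : ∀ x : ℤ, (2 : ℤ) ^ e ∣ 2 ^ k * x := fun x =>
      (pow_dvd_pow 2 (by omega)).mul_right x
    rw [charCoeff_succ hM, charCoeff_succ hM']
    exact (Int.emod_eq_zero_of_dvd (hdvd _)).trans (Int.emod_eq_zero_of_dvd (hdvd _)).symm
  · exact h k hk hke

theorem residueTuple_eq_iff (hM : M ∈ symmSignMatrices n) (hM' : M' ∈ symmSignMatrices n) :
    ((fun k : Finset.Icc 2 e => (charCoeff M k : ZMod (2 ^ e)))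
      = fun k : Finset.Icc 2 e => (charCoeff M' k : ZMod (2 ^ e))) ↔ CharCongr e M M' := by
  have hcast : ∀ a b : ℤ, (a : ZMod (2 ^ e)) = b ↔ a ≡ b [ZMOD 2 ^ e] := fun a b => by
    rw [ZMod.intCast_eq_intCast_iff]; push_cast; rfl
  rw [charCongr_iff hM hM', funext_iff]
  refine ⟨fun h k hk hke => (hcast _ _).mp (h ⟨k, Finset.mem_Icc.mpr ⟨by omega, hke⟩⟩),
    fun h k => (hcast _ _).mpr ?_⟩
  exact (charCongr_iff hM hM').mpr h k

theorem charpoly_map_eq_iff (M M' : Matrix (Fin n) (Fin n) ℤ) :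
    M.charpoly.map (Int.castRingHom (ZMod (2 ^ e)))
      = M'.charpoly.map (Int.castRingHom (ZMod (2 ^ e))) ↔ CharCongr e M M' := by
  have hcast : ∀ a b : ℤ, (a : ZMod (2 ^ e)) = b ↔ a ≡ b [ZMOD 2 ^ e] := fun a b => by
    rw [ZMod.intCast_eq_intCast_iff]; push_cast; rfl
  rw [Polynomial.ext_iff]
  simp only [Polynomial.coeff_map, eq_intCast, hcast]
  refine ⟨fun h k => ?_, fun h i => ?_⟩
  · unfold charCoeff
    split_ifs
    · exact h _
    · rfl
  · rcases Nat.lt_or_ge n i with hi | hi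
    · have hz : ∀ M : Matrix (Fin n) (Fin n) ℤ, M.charpoly.coeff i = 0 := fun M =>
        Polynomial.coeff_eq_zero_of_natDegree_lt (by simpa using hi)
      rw [hz, hz]
    · have := h (n - i)
      rwa [charCoeff, charCoeff, if_pos (by omega), if_pos (by omega), Nat.sub_sub_self hi] at this

/-- The free data of a class: the parity of `b_3` and the residues of `⌊b_k / 2⌋` modulo
`2 ^ (e - k)` for `3 ≤ k ≤ e`. -/
noncomputable def classData (e : ℕ) (M : Matrix (Fin n) (Fin n) ℤ) :
    ZMod 2 × (∀ k : Finset.Icc 3 e, ZMod (2 ^ (e - (k : ℕ)))) :=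
  (halvedCoeff M 3, fun k => ((halvedCoeff M k / 2 : ℤ) : ZMod (2 ^ (e - (k : ℕ)))))

theorem modEq_two_mul_iff {a b m : ℤ} :
    a ≡ b [ZMOD 2 * m] ↔ a ≡ b [ZMOD 2] ∧ a / 2 ≡ b / 2 [ZMOD m] := by
  simp only [Int.modEq_iff_dvd]
  constructor
  · rintro ⟨c, hc⟩
    have hc' : b - a = 2 * (m * c) := by rw [hc]; ring
    exact ⟨⟨m * c, hc'⟩, ⟨c, by omega⟩⟩
  · rintro ⟨⟨d, hd⟩, ⟨c, hc⟩⟩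
    refine ⟨c, ?_⟩
    rw [mul_assoc, ← hc]
    omega

/-- The lowest bits of the `b_k` are recovered by induction on `k` from the class data. -/
theorem classData_eq_iff (he : 3 ≤ e) (hM : M ∈ symmSignMatrices n)
    (hM' : M' ∈ symmSignMatrices n) : classData e M = classData e M' ↔ CharCongr e M M' := by
  have hdata : classData e M = classData e M' ↔ halvedCoeff M 3 ≡ halvedCoeff M' 3 [ZMOD 2] ∧
      ∀ k, 3 ≤ k → k ≤ e → halvedCoeff M k / 2 ≡ halvedCoeff M' k / 2 [ZMOD 2 ^ (e - k)] := by
    simp only [classData, Prod.mk.injEq, funext_iff, ZMod.intCast_eq_intCast_iff, Subtype.forall,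
      Finset.mem_Icc, and_imp, Nat.cast_pow, Nat.cast_ofNat]
  have hpow : ∀ k ≤ e, (2 : ℤ) ^ (e + 1 - k) = 2 * 2 ^ (e - k) := fun k hk => by
    rw [← pow_succ', Nat.sub_add_comm hk]
  rw [hdata, charCongr_iff hM hM']
  constructor
  · rintro ⟨h3, h⟩
    have key : ∀ k, 3 ≤ k → k ≤ e →
        halvedCoeff M k ≡ halvedCoeff M' k [ZMOD 2 ^ (e + 1 - k)] := by
      intro k
      induction k using Nat.strong_induction_on with
      | _ k ih =>
        intro hk hke
        rw [hpow k hke, modEq_two_mul_iff]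
        refine ⟨?_, h k hk hke⟩
        obtain rfl | hk4 : k = 3 ∨ 4 ≤ k := by omega
        · exact h3
        · refine halvedCoeff_modEq_two hM hM' hk4 fun j hj hjk => ?_
          refine (ih j hjk hj (by omega)).of_dvd ?_
          exact pow_dvd_pow 2 (show 2 ≤ e + 1 - j by omega)
    exact fun k hk hke => (charCoeff_modEq_iff hM hM' (by omega) hke).mpr (key k hk hke)
  · intro h
    have key : ∀ k, 3 ≤ k → k ≤ e → halvedCoeff M k ≡ halvedCoeff M' k [ZMOD 2] ∧
        halvedCoeff M k / 2 ≡ halvedCoeff M' k / 2 [ZMOD 2 ^ (e - k)] := fun k hk hke => by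
      rw [← modEq_two_mul_iff, ← hpow k hke]
      exact (charCoeff_modEq_iff hM hM' (by omega) hke).mp (h k hk hke)
    exact ⟨(key 3 le_rfl he).1, fun k hk hke => (key k hk hke).2⟩

/-- For large `n` all class data occur, except that `b_3` is even for even `n`. -/
theorem exists_classData_eq (he : 3 ≤ e) : ∃ N, ∀ n ≥ N,
    ∀ y : ZMod 2 × (∀ k : Finset.Icc 3 e, ZMod (2 ^ (e - (k : ℕ)))), (Odd n ∨ y.1 = 0) →
      ∃ M ∈ symmSignMatrices n, classData e M = y := by
  obtain ⟨N, hN⟩ := exists_signPoly_coeff (q := 2 ^ e) (e := e) (by positivity) he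
  refine ⟨N, fun n hn => ?_⟩
  rintro ⟨ε, y⟩ hε
  choose β hβ using fun k => ZMod.intCast_surjective (y k)
  obtain ⟨A, hA, ⟨γ, hγ⟩, hj⟩ := hN n hn ε hε
    (fun j => if h : j ∈ Finset.Icc 3 e then β ⟨j, h⟩ else 0)
  have hhalved : ∀ j, halvedCoeff (onesMatrix _ ℤ - (2 : ℤ) • A) j = (signPoly A).coeff j :=
    fun j => by rw [halvedCoeff, graphOf_ones_sub]
  have hcast : ∀ a b : ℤ, (a : ZMod (2 ^ e)) = b → a ≡ b [ZMOD 2 ^ e] := fun a b h => by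
    rw [ZMod.intCast_eq_intCast_iff] at h; exact_mod_cast h
  refine ⟨_, hA.ones_sub_mem, Prod.ext ?_ (funext fun k => ?_)⟩
  · have h1 : (signPoly A).coeff 3 ≡ (ε.val : ℤ) + 2 * γ [ZMOD 2] :=
      (hcast _ _ (by push_cast; exact hγ)).of_dvd (dvd_pow_self 2 (by omega))
    have h2 := (ZMod.intCast_eq_intCast_iff _ _ 2).mpr h1
    simp only [classData, hhalved]
    rw [h2]
    push_cast
    have h3 : (2 : ZMod 2) = 0 := rfl
    rw [h3, zero_mul, add_zero]
    exact ZMod.natCast_zmod_val ε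
  · obtain ⟨k, hk⟩ := k
    have hk' := Finset.mem_Icc.mp hk
    obtain ⟨δ, hδ, hδ'⟩ := hj k hk'.1 hk'.2
    rw [dif_pos hk] at hδ'
    have h1 : (signPoly A).coeff k ≡ δ + 2 * β ⟨k, hk⟩ [ZMOD 2 * 2 ^ (e - k)] := by
      refine (hcast _ _ (by push_cast; exact hδ')).of_dvd ?_
      rw [← pow_succ']
      exact pow_dvd_pow 2 (by omega)
    have h2 := (modEq_two_mul_iff.mp h1).2
    rw [show (δ + 2 * β ⟨k, hk⟩) / 2 = β ⟨k, hk⟩ by omega] at h2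
    simp only [classData, hhalved]
    rw [← hβ ⟨k, hk⟩, ZMod.intCast_eq_intCast_iff]
    exact_mod_cast h2

theorem ncard_image_eq_of_eq_iff {α β γ : Type*} {S : Set α} {f : α → β} {g : α → γ}
    (h : ∀ x ∈ S, ∀ y ∈ S, f x = f y ↔ g x = g y) : (f '' S).ncard = (g '' S).ncard := by
  have hex : ∀ b ∈ f '' S, ∃ x ∈ S, f x = b := fun b hb => hb
  refine Set.ncard_congr (fun b hb => g (hex b hb).choose) (fun b hb => ?_) ?_ ?_
  · exact ⟨_, (hex b hb).choose_spec.1, rfl⟩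
  · intro a b ha hb hab
    have h1 := (h _ (hex a ha).choose_spec.1 _ (hex b hb).choose_spec.1).mpr hab
    rwa [(hex a ha).choose_spec.2, (hex b hb).choose_spec.2] at h1
  · rintro _ ⟨x, hx, rfl⟩
    have hb : f x ∈ f '' S := ⟨x, hx, rfl⟩
    exact ⟨f x, hb, (h _ (hex _ hb).choose_spec.1 _ hx).mp (hex _ hb).choose_spec.2⟩

theorem sum_Icc_sub (e : ℕ) : ∑ k ∈ Finset.Icc 3 e, (e - k) = Nat.choose (e - 2) 2 := by
  rw [Nat.choose_two_right, ← Finset.sum_range_id]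
  refine Finset.sum_nbij' (fun k => e - k) (fun i => e - i) ?_ ?_ ?_ ?_ (fun _ _ => rfl) <;>
    simp only [Finset.mem_Icc, Finset.mem_range] <;> intro k hk <;> omega

theorem card_free_data (e : ℕ) :
    Nat.card (∀ k : Finset.Icc 3 e, ZMod (2 ^ (e - (k : ℕ)))) = 2 ^ Nat.choose (e - 2) 2 := by
  rw [Nat.card_pi]
  simp only [Nat.card_zmod]
  rw [Finset.prod_coe_sort (Finset.Icc 3 e) (fun k => 2 ^ (e - k)), Finset.prod_pow_eq_pow_sum,
    sum_Icc_sub]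

theorem ncard_classData_image_even (hn : Even n)
    (hsurj : ∀ y : ZMod 2 × (∀ k : Finset.Icc 3 e, ZMod (2 ^ (e - (k : ℕ)))), (Odd n ∨ y.1 = 0) →
      ∃ M ∈ symmSignMatrices n, classData e M = y) :
    (classData e '' symmSignMatrices n).ncard = 2 ^ Nat.choose (e - 2) 2 := by
  have himage : classData e '' symmSignMatrices n = {0} ×ˢ Set.univ := by
    ext y
    constructor
    · rintro ⟨M, hM, rfl⟩
      refine ⟨?_, Set.mem_univ _⟩
      exact (ZMod.intCast_zmod_eq_zero_iff_dvd _ 2).mpr (two_dvd_halvedCoeff hn hM 3)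
    · rintro ⟨hy, -⟩
      exact hsurj y (Or.inr hy)
  rw [himage, Set.ncard_prod, Set.ncard_singleton, Set.ncard_univ, card_free_data, one_mul]

theorem ncard_classData_image_odd (hn : Odd n)
    (hsurj : ∀ y : ZMod 2 × (∀ k : Finset.Icc 3 e, ZMod (2 ^ (e - (k : ℕ)))), (Odd n ∨ y.1 = 0) →
      ∃ M ∈ symmSignMatrices n, classData e M = y) :
    (classData e '' symmSignMatrices n).ncard = 2 ^ (Nat.choose (e - 2) 2 + 1) := by
  have himage : classData e '' symmSignMatrices n = Set.univ :=
    Set.eq_univ_of_forall fun y => hsurj y (Or.inl hn)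
  rw [himage, Set.ncard_univ, Nat.card_prod, card_free_data, Nat.card_zmod, pow_succ, mul_comm]

theorem ncard_residueTuples (he : 3 ≤ e) : (residueTuples e (symmSignMatrices n)).ncard
    = (classData e '' symmSignMatrices n).ncard := by
  have himage : residueTuples e (symmSignMatrices n)
      = (fun (M : Matrix (Fin n) (Fin n) ℤ) (k : Finset.Icc 2 e) =>
          (charCoeff M k : ZMod (2 ^ e))) '' symmSignMatrices n := by
    ext t
    exact ⟨fun ⟨M, hM, h⟩ => ⟨M, hM, (funext h).symm⟩,
      fun ⟨M, hM, h⟩ => ⟨M, hM, fun k => (congrFun h k).symm⟩⟩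
  rw [himage]
  exact ncard_image_eq_of_eq_iff fun M hM M' hM' =>
    (residueTuple_eq_iff hM hM').trans (classData_eq_iff he hM hM').symm

theorem ncard_charpolyClasses (he : 3 ≤ e) : (charpolyClasses e (symmSignMatrices n)).ncard
    = (classData e '' symmSignMatrices n).ncard := by
  have himage : charpolyClasses e (symmSignMatrices n)
      = (fun M : Matrix (Fin n) (Fin n) ℤ => M.charpoly.map (Int.castRingHom (ZMod (2 ^ e)))) ''
          symmSignMatrices n := by
    ext p
    exact ⟨fun ⟨M, hM, h⟩ => ⟨M, hM, h.symm⟩, fun ⟨M, hM, h⟩ => ⟨M, hM, h.symm⟩⟩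
  rw [himage]
  exact ncard_image_eq_of_eq_iff fun M hM M' hM' =>
    (charpoly_map_eq_iff M M').trans (classData_eq_iff he hM hM').symm

end Counting

theorem theorem2 (e : ℕ) (he : 3 ≤ e) :
    ∃ N : ℕ, ∀ n : ℕ, N < n →
      (Even n →
        (residueTuples e (symmSignMatrices n)).ncard = 2 ^ Nat.choose (e - 2) 2 ∧
        (charpolyClasses e (symmSignMatrices n)).ncard = 2 ^ Nat.choose (e - 2) 2) ∧
      (Odd n →
        (residueTuples e (symmSignMatrices n)).ncard = 2 ^ (Nat.choose (e - 2) 2 + 1) ∧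
        (charpolyClasses e (symmSignMatrices n)).ncard = 2 ^ (Nat.choose (e - 2) 2 + 1)) := by
  obtain ⟨N, hN⟩ := exists_classData_eq he
  refine ⟨N, fun n hn => ?_⟩
  have hsurj := hN n hn.le
  rw [ncard_residueTuples he, ncard_charpolyClasses he]
  exact ⟨fun hp => ⟨ncard_classData_image_even hp hsurj, ncard_classData_image_even hp hsurj⟩,
    fun hp => ⟨ncard_classData_image_odd hp hsurj, ncard_classData_image_odd hp hsurj⟩⟩
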